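/- Let $G$ be a finite simple undirected graph with $m$ edges and two distinct vertices $s$ (the sender) and $r$ (the receiver). An instruction is a triple $uvw$ where $u\neq w$ are neighbors of $v$, and a protocol is a set $A$ of instructions. An $A$-walk is a walk $s=v_0,v_1,\dots,v_k=r$ in $G$ (vertices may repeat) such that $v_{i-1}v_iv_{i+1}\in A$ for all $1\le i\le k-1$; the protocol $A$ is finite if there are only finitely many $A$-walks. For $p\in[0,1]$, let $\rho_A(G,p)$ be the probability that all edges of some $A$-walk survive when each edge of $G$ survives independently with probability $p$, and let $\hat\rho(G,p)=\max\{\rho_A(G,p): A\text{ a finite protocol}\}$. A finite protocol $A_1$ is called optimal near one if there is an $\varepsilon>0$ such that $\hat\rho(G,p)=\rho_{A_1}(G,p)$ for all $p\in(1-\varepsilon,1]$. Let $e$ be the $s,r$ edge-connectivity of $G$, i.e. the minimum size of an $s,r$ edge cut (a set of edges whose removal disconnects $s$ from $r$), and let $c_e$ be the number of $s,r$ edge cuts of size $e$. Theorem. A finite protocol that is optimal near one exists. Moreover there is a constant $C$ (depending only on $G,s,r$) such that for every finite protocol $A_1$ that is optimal near one and every $q=1-p$ with $0\le q<3^{-m}$,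 $$\hat\rho(G,p)=\rho_{A_1}(G,p)\qquad\text{and}\qquad \left|\rho_{A_1}(G,p)-\left(1-c_eq^e\right)\right|\le C\,q^{e+1},$$ where $q^0=1$; that is, $\hat\rho(G,p)=\rho_{A_1}(G,p)=1-c_eq^e+O(q^{e+1})$. -/

import Mathlib

/-- An instruction `(u, v, w)` of `G`: two different neighbours `u`, `w` of a vertex `v`
("if `v` receives the message from `u`, it passes it on to `w`"). -/
def IsInstruction {V : Type*} (G : SimpleGraph V) (t : V × V × V) : Prop :=
  G.Adj t.1 t.2.1 ∧ G.Adj t.2.1 t.2.2 ∧ t.1 ≠ t.2.2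

/-- A protocol of `G` is a set of instructions of `G`. -/
def IsProtocol {V : Type*} (G : SimpleGraph V) (A : Set (V × V × V)) : Prop :=
  ∀ t ∈ A, IsInstruction G t

/-- An `A`-walk: a walk from `s` to `r` (vertices may repeat) all of whose consecutive triples
`v_i, v_{i+1}, v_{i+2}` are in `A`. As instructions satisfy `u ≠ w`, such a walk for a protocol
`A` never turns straight back along an edge. -/
def IsProtocolWalk {V : Type*} {G : SimpleGraph V} {s r : V} (A : Set (V × V × V))
    (W : G.Walk s r) : Prop :=
  ∀ i : ℕ, i + 2 ≤ W.length → (W.getVert i, W.getVert (i + 1), W.getVert (i + 2)) ∈ A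

/-- A finite protocol: a protocol with only finitely many `A`-walks from `s` to `r`. -/
def IsFiniteProtocol {V : Type*} (G : SimpleGraph V) (s r : V) (A : Set (V × V × V)) : Prop :=
  IsProtocol G A ∧ {W : G.Walk s r | IsProtocolWalk A W}.Finite

/-- The message gets through when exactly the edges in `S` survive: some `A`-walk from `s` to `r`
has all its edges in `S`. -/
def Delivers {V : Type*} (G : SimpleGraph V) (s r : V) (A : Set (V × V × V))
    (S : Finset (Sym2 V)) : Prop :=
  ∃ W : G.Walk s r, IsProtocolWalk A W ∧ ∀ e ∈ W.edges, e ∈ S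

open Classical in
/-- The reliability `ρ_A(G, p)`: the probability that some `A`-walk survives if each edge `e`
survives with probability `p e`, independently, written as the sum over all sets `S` of surviving
edges for which the message gets through of the probability that exactly `S` survives. -/
noncomputable def reliability {V : Type*} [Fintype V] (G : SimpleGraph V) (s r : V)
    (A : Set (V × V × V)) (p : Sym2 V → ℝ) : ℝ :=
  ∑ S ∈ G.edgeFinset.powerset with Delivers G s r A S,
    (∏ e ∈ S, p e) * ∏ e ∈ G.edgeFinset \ S, (1 - p e)

/-- The optimal reliability: the maximum of `ρ_A(G, p)` over all finite protocols `A`. The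
supremum is over a finite nonempty set, see `optimalReliability_isGreatest`. -/
noncomputable def optimalReliability {V : Type*} [Fintype V] (G : SimpleGraph V) (s r : V)
    (p : Sym2 V → ℝ) : ℝ :=
  sSup {x : ℝ | ∃ A : Set (V × V × V), IsFiniteProtocol G s r A ∧ reliability G s r A p = x}

theorem isFiniteProtocol_empty {V : Type*} [Fintype V] (G : SimpleGraph V) (s r : V) :
    IsFiniteProtocol G s r ∅ := by
  classical
  refine ⟨fun t ht => ht.elim, ?_⟩
  have h : {W : G.Walk s r | W.length < 2}.Finite := Set.toFinite _
  refine h.subset fun W hW => ?_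
  by_contra hlen
  exact hW 0 (Nat.le_of_not_lt hlen)

theorem optimalReliability_isGreatest {V : Type*} [Fintype V] (G : SimpleGraph V) (s r : V)
    (p : Sym2 V → ℝ) :
    IsGreatest {x : ℝ | ∃ A : Set (V × V × V),
      IsFiniteProtocol G s r A ∧ reliability G s r A p = x} (optimalReliability G s r p) := by
  have hfin : {x : ℝ | ∃ A : Set (V × V × V),
      IsFiniteProtocol G s r A ∧ reliability G s r A p = x}.Finite :=
    (Set.finite_range fun A : Set (V × V × V) => reliability G s r A p).subset
      fun x ⟨A, _, hA⟩ => ⟨A, hA⟩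
  have hne : {x : ℝ | ∃ A : Set (V × V × V),
      IsFiniteProtocol G s r A ∧ reliability G s r A p = x}.Nonempty :=
    ⟨_, ∅, isFiniteProtocol_empty G s r, rfl⟩
  exact ⟨hne.csSup_mem hfin, fun x hx => le_csSup hfin.bddAbove hx⟩

/-- `A` is an optimal finite protocol near one: it is finite and, for some `ε > 0`, attains the
optimal reliability for every constant edge probability `p ∈ (1 - ε, 1]`. -/
def IsOptimalNearOne {V : Type*} [Fintype V] (G : SimpleGraph V) (s r : V)
    (A : Set (V × V × V)) : Prop :=
  IsFiniteProtocol G s r A ∧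
    ∃ ε > (0 : ℝ), ∀ p ∈ Set.Ioc (1 - ε) 1,
      optimalReliability G s r (fun _ => p) = reliability G s r A (fun _ => p)

/-- An `s,r` edge cut: a set of edges of `G` whose removal disconnects `s` from `r`. -/
def IsEdgeCut {V : Type*} (G : SimpleGraph V) (s r : V) (F : Finset (Sym2 V)) : Prop :=
  (F : Set (Sym2 V)) ⊆ G.edgeSet ∧ ¬ (G.deleteEdges (F : Set (Sym2 V))).Reachable s r

/-- The `s,r` edge-connectivity: the minimum size of an `s,r` edge cut. (For `s ≠ r` the set of
all edges is an `s,r` edge cut, so the infimum is over a nonempty set.) -/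
noncomputable def edgeConnectivity {V : Type*} (G : SimpleGraph V) (s r : V) : ℕ :=
  sInf {k : ℕ | ∃ F : Finset (Sym2 V), IsEdgeCut G s r F ∧ F.card = k}

/-- The number of minimum `s,r` edge cuts. -/
noncomputable def numMinEdgeCuts {V : Type*} (G : SimpleGraph V) (s r : V) : ℕ :=
  {F : Finset (Sym2 V) | IsEdgeCut G s r F ∧ F.card = edgeConnectivity G s r}.ncard

/-! Every protocol fails when a minimum cut fails, which gives the upper bound. The lower bound
needs one finite protocol that withstands every failure of at most `e` edges that is not a cut
(`exists_finite_protocol_delivers`); an optimal protocol is at least as reliable, so it has the same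
leading term.

Take `e` edge-disjoint `s,r` paths and a spanning forest `T` of the rest of the graph. If at most
`e` failures stop every path, then each path loses exactly one edge and `T` is intact. Contracting
the components of `T` turns the paths into trails, and a single switch from the intact start of a
trail to the intact end of a trail, at a common vertex, delivers the message. Allowing all switches
could create infinitely many walks, so the positions where a trail may be left are restricted.

`exists_switching_rank` chooses these positions. A chain of states sweeps the trails from start to
end, and a trail may be left at a position only if some state has just passed it while no trail has
yet left its vertex. Counting the states behind a position gives a rank that increases along trails
and at such switches, which yields finiteness. The sweep is built so that, if none of these switches
avoids the failures, then no vertex before the failures recurs after them, and the failures form a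
cut.

For the range of `q`, the difference of two reliabilities in Bernstein form has integral
coefficients bounded by binomial coefficients. By `bernstein_sum_lower_bound` its sign is constant
for `0 < q < 3 ^ (-m)`, so a protocol optimal at one such `q` is optimal at all of them. -/

/-! ### Sweeping a finite family of trails through a common vertex set -/

section Sweep

variable {I Q : Type*}

/-- The last vertex passed by the `i`-th trail in the state `b` lies at position `n`, and no trail
has left this vertex before the state `b`. -/
def FreshAt (L : I → ℕ) (v : I → ℕ → Q) (b : I → ℕ) (i : I) (n : ℕ) : Prop :=
  b i = n + 1 ∧ ∀ k l, l < L k → v k l = v i n → b k ≤ l + 1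

/-- If each trail `i` is cut just before position `F i`, then it is possible to switch at a vertex
which is fresh in one of the states in `S` from a trail to the end of another trail. -/
def Covers (L : I → ℕ) (v : I → ℕ → Q) (S : Set (I → ℕ)) (F : I → ℕ) : Prop :=
  ∃ b ∈ S, ∃ i n, FreshAt L v b i n ∧ n < F i ∧ ∃ j m, F j ≤ m ∧ m < L j ∧ v j m = v i n

theorem Covers.mono {L : I → ℕ} {v : I → ℕ → Q} {S S' : Set (I → ℕ)} (h : S ⊆ S') {F : I → ℕ}
    (hF : Covers L v S F) : Covers L v S' F := by
  obtain ⟨b, hb, hr⟩ := hF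
  exact ⟨b, h hb, hr⟩

/-- The invariants of a sweep: `S` is a chain of states with last element `b`, the state `a` is a
cut up to which everything is settled, and `r` groups the trails together. -/
structure IsSweep (L : I → ℕ) (v : I → ℕ → Q) (a b : I → ℕ) (r : I → I → Prop)
    (S : Set (I → ℕ)) : Prop where
  equiv : Equivalence r
  lt : ∀ i, a i < b i
  le : ∀ i, b i ≤ L i
  mem : b ∈ S
  chain : IsChain (· ≤ ·) S
  top : ∀ s ∈ S, s ≤ b
  cut : ∀ i n j m, n < a i → a j ≤ m → m < L j → v i n ≠ v j m
  base : ∀ F, ¬ Covers L v S F → ∀ i n j m, n < a i → n < F i → F j ≤ m → m < L j → v i n ≠ v j m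
  -- An uncovered `F` thus cuts a whole group at or before `a`, or a whole group at or after `b`.
  mixed : ∀ F i j, r i j → a i < F i → F j < b j → Covers L v S F
  -- The last vertex before `b` is exempt: through it a group may meet other groups, and this is
  -- what triggers merging.
  inner : ∀ i n h m, a i ≤ n → n + 1 < b i → a h ≤ m → m < L h → v i n = v h m → r i h
  -- When a passed vertex recurs later, a switch at this vertex is thus already available on some
  -- trail of the group.
  fresh : ∀ i n, a i ≤ n → n < b i →
    ∃ s ∈ S, ∃ i' n', r i i' ∧ FreshAt L v s i' n' ∧ v i' n' = v i n

/-- A completed sweep. -/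
def IsSwept (L : I → ℕ) (v : I → ℕ → Q) (S : Set (I → ℕ)) : Prop :=
  IsChain (· ≤ ·) S ∧ (∀ s ∈ S, s ≤ L) ∧
    ∀ F, ¬ Covers L v S F → ∀ i n j m, n < L i → n < F i → F j ≤ m → m < L j → v i n ≠ v j m

theorem isSweep_init {L : I → ℕ} {v : I → ℕ → Q} (hL : ∀ i, 0 < L i) :
    IsSweep L v (fun _ => 0) (fun _ => 1) Eq {fun _ => 1} where
  equiv := ⟨fun _ => rfl, fun h => h.symm, fun h h' => h.trans h'⟩
  lt := by simp
  le := fun i => hL i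
  mem := rfl
  chain := by simp
  top := by simp
  cut := by simp
  base := by simp
  mixed := by
    rintro F i j rfl h h'
    omega
  inner := by
    intro i n h m h1 h2
    omega
  fresh := by
    intro i n _ hn
    exact ⟨_, rfl, i, n, rfl, ⟨(Nat.lt_one_iff.1 hn) ▸ rfl, fun k l _ _ => Nat.le_add_left 1 l⟩, rfl⟩

theorem isChain_insert_top {S : Set (I → ℕ)} {b b' : I → ℕ} (hS : IsChain (· ≤ ·) S)
    (htop : ∀ s ∈ S, s ≤ b) (hb : b ≤ b') :
    IsChain (· ≤ ·) (insert b' S) ∧ ∀ s ∈ insert b' S, s ≤ b' := by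
  refine ⟨hS.insert fun s hs _ => Or.inr ((htop s hs).trans hb), ?_⟩
  rintro s (rfl | hs)
  · exact le_rfl
  · exact (htop s hs).trans hb

/-- Advancing one trail whose rest returns to a vertex already passed by its group. -/
theorem IsSweep.advance {L : I → ℕ} {v : I → ℕ → Q} {a b : I → ℕ} {r : I → I → Prop}
    {S : Set (I → ℕ)} (H : IsSweep L v a b r S) [DecidableEq I] {j : I}
    (hout : ∀ i n h m, r j i → a i ≤ n → n < b i → a h ≤ m → m < L h → v i n = v h m → r i h)
    {i : I} {n m : ℕ} (hji : r j i) (hn : a i ≤ n) (hnb : n < b i) (hm : b j ≤ m) (hmL : m < L j)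
    (hv : v i n = v j m) :
    IsSweep L v a (Function.update b j (b j + 1)) r
      (insert (Function.update b j (b j + 1)) S) := by
  have hbb : b ≤ Function.update b j (b j + 1) := by
    intro k
    by_cases hk : k = j
    · subst hk; simp
    · simp [hk]
  have hup : ∀ k l, l < Function.update b j (b j + 1) k → l < b k ∨ (k = j ∧ l = b j) := by
    intro k l
    by_cases hk : k = j
    · subst hk; simp; omega
    · simp only [ne_eq, hk, not_false_eq_true, Function.update_of_ne]; tauto
  have hinner : ∀ i n h m, a i ≤ n → n + 1 < Function.update b j (b j + 1) i → a h ≤ m →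
      m < L h → v i n = v h m → r i h := by
    intro i n h m h1 h2 h3 h4 h5
    rcases hup i (n + 1) h2 with h6 | ⟨rfl, h6⟩
    · exact H.inner i n h m h1 h6 h3 h4 h5
    · exact hout i n h m (H.equiv.refl _) h1 (by omega) h3 h4 h5
  obtain ⟨hch, htop⟩ := isChain_insert_top H.chain H.top hbb
  refine
    { equiv := H.equiv
      lt := fun k => (H.lt k).trans_le (hbb k)
      le := ?_
      mem := Set.mem_insert _ _
      chain := hch
      top := htop
      cut := H.cut
      base := fun F hF => H.base F fun hc => hF (hc.mono (Set.subset_insert _ _))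
      mixed := ?_
      inner := hinner
      fresh := ?_ }
  · intro k
    by_cases hk : k = j
    · subst hk; simp; omega
    · simpa [hk] using H.le k
  · intro F x y hxy hx hy
    rcases hup y (F y) hy with h1 | ⟨rfl, h1⟩
    · exact (H.mixed F x y hxy hx h1).mono (Set.subset_insert _ _)
    -- Only `F y = b y` is new. If `F` spares the passed part of the group, the fresh occurrence of
    -- the recurring vertex lies before the cut, and position `m` of trail `y` lies after it.
    by_cases hall : ∃ z, r y z ∧ F z < b z
    · obtain ⟨z, hz, hFz⟩ := hall
      exact (H.mixed F x z (H.equiv.trans hxy hz) hx hFz).mono (Set.subset_insert _ _)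
    push Not at hall
    obtain ⟨s, hs, i', n', hii', hfr, hv'⟩ := H.fresh i n hn hnb
    refine ⟨s, Set.mem_insert_of_mem _ hs, i', n', hfr, ?_, y, m, by omega, hmL, ?_⟩
    · have h2 := hall i' (H.equiv.trans hji hii')
      have h3 : s i' ≤ b i' := H.top s hs i'
      have h4 : s i' = n' + 1 := hfr.1
      omega
    · rw [hv', hv]
  · intro k l hkl hlk
    rcases hup k l hlk with h1 | ⟨rfl, rfl⟩
    · obtain ⟨s, hs, hr⟩ := H.fresh k l hkl h1
      exact ⟨s, Set.mem_insert_of_mem _ hs, hr⟩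
    -- A vertex already in the window of the group has a fresh position. Otherwise the new state is
    -- fresh at it, because `hinner` puts any trail that has left it into the group.
    by_cases hold : ∃ x y, r k x ∧ a x ≤ y ∧ y < b x ∧ v x y = v k (b k)
    · obtain ⟨x, y, hkx, h1, h2, h3⟩ := hold
      obtain ⟨s, hs, i', n', h4, h5, h6⟩ := H.fresh x y h1 h2
      exact ⟨s, Set.mem_insert_of_mem _ hs, i', n', H.equiv.trans hkx h4, h5, h6.trans h3⟩
    push Not at hold
    refine ⟨_, Set.mem_insert _ _, k, b k, H.equiv.refl _, ⟨by simp, ?_⟩, rfl⟩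
    intro x y hy hxy
    by_contra hlt
    push Not at hlt
    by_cases hax : y < a x
    · exact H.cut x y k (b k) hax hkl (by omega) hxy
    push Not at hax
    have h1 := hinner x y k (b k) hax hlt hkl (by omega) hxy
    refine hold x y (H.equiv.symm h1) hax ?_ hxy
    rcases hup x (y + 1) hlt with h2 | ⟨rfl, h2⟩ <;> omega

/-- Merging groups all of which are about to reach a trail of another one of them. -/
theorem IsSweep.merge {L : I → ℕ} {v : I → ℕ → Q} {a b : I → ℕ} {r : I → I → Prop}
    {S : Set (I → ℕ)} (H : IsSweep L v a b r S) {t : I → I → Prop} (ht : Equivalence t)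
    (hrt : ∀ i j, r i j → t i j)
    (hcross : ∀ (P : I → Prop), (∀ i j, r i j → P i → P j) → ∀ x y, t x y → P x → ¬ P y →
      ∃ i n h m, P i ∧ ¬ P h ∧ a i ≤ n ∧ n < b i ∧ a h ≤ m ∧ m < L h ∧ v i n = v h m) :
    IsSweep L v a b t S := by
  refine
    { H with
      equiv := ht
      mixed := ?_
      inner := fun i n h m h1 h2 h3 h4 h5 => hrt _ _ (H.inner i n h m h1 h2 h3 h4 h5)
      fresh := ?_ }
  · intro F x y hxy hx hy
    by_contra hcov
    have hcov' : ∀ i j, r i j → a i < F i → b j ≤ F j := fun i j hij hi => by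
      by_contra hj
      exact hcov (H.mixed F i j hij hi (not_le.1 hj))
    -- For an uncovered `F` the trails cut beyond `a` form a union of groups; `hcross` finds a
    -- vertex shared across its boundary.
    obtain ⟨i, n, h, m, hi, hh, h1, h2, h3, h4, h5⟩ := hcross (fun z => a z < F z)
      (fun i j hij hi => (H.lt j).trans_le (hcov' i j hij hi)) x y hxy hx (fun h => by
        have := hcov' y y (H.equiv.refl _) h
        omega)
    have hne : ¬ r i h := fun hr => hh ((H.lt h).trans_le (hcov' i h hr hi))
    have hn : b i = n + 1 := by
      by_contra hn
      exact hne (H.inner i n h m h1 (by omega) h3 h4 h5)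
    have hbF := hcov' i i (H.equiv.refl _) hi
    -- By `inner` the shared vertex is the last one passed by trail `i`. It is fresh in `b`, since a
    -- trail that had left it would be related to both `i` and `h`.
    refine hcov ⟨b, H.mem, i, n, ⟨hn, ?_⟩, by omega, h, m, by omega, h4, h5.symm⟩
    intro k l hl hkl
    by_contra hlt
    push Not at hlt
    by_cases hak : l < a k
    · exact H.cut k l i n hak h1 (by have := H.le i; omega) hkl
    push Not at hak
    have e1 := H.inner k l i n hak hlt h1 (by have := H.le i; omega) hkl
    have e2 := H.inner k l h m hak hlt h3 h4 (hkl.trans h5)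
    exact hne (H.equiv.trans (H.equiv.symm e1) e2)
  · intro i n h1 h2
    obtain ⟨s, hs, i', n', h3, h4⟩ := H.fresh i n h1 h2
    exact ⟨s, hs, i', n', hrt _ _ h3, h4⟩

open Classical in
/-- When the state of one group is a cut, then everything up to this cut is settled: either the
sweep is complete, or the group is dissolved and its trails are advanced by one step. -/
theorem IsSweep.reset {L : I → ℕ} {v : I → ℕ → Q} {a b : I → ℕ} {r : I → I → Prop}
    {S : Set (I → ℕ)} (H : IsSweep L v a b r S) (hL : ∀ i, 0 < L i)
    (hend : ∀ i j, v i (L i - 1) = v j (L j - 1)) (i₀ : I)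
    (hcut : ∀ i n j m, n < (if r i₀ i then b i else a i) → (if r i₀ j then b j else a j) ≤ m →
      m < L j → v i n ≠ v j m) :
    IsSwept L v S ∨ ∃ a' r' S',
      IsSweep L v a' (fun i => if r i₀ i then b i + 1 else b i) r' S' := by
  have hbase : ∀ F, ¬ Covers L v S F → ∀ i n j m, n < (if r i₀ i then b i else a i) → n < F i →
      F j ≤ m → m < L j → v i n ≠ v j m := by
    intro F hF i n j m h1 h2 h3 h4 h5
    by_cases hna : n < a i
    · exact H.base F hF i n j m hna h2 h3 h4 h5
    push Not at hna
    by_cases hi : r i₀ i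
    swap
    · rw [if_neg hi] at h1
      omega
    have hbF : ∀ k, r i₀ k → b k ≤ F k := by
      intro k hk
      by_contra hlt
      exact hF (H.mixed F i k (H.equiv.trans (H.equiv.symm hi) hk) (by omega) (not_le.1 hlt))
    have h6 : m < (if r i₀ j then b j else a j) := by
      by_contra h6
      exact hcut i n j m h1 (not_lt.1 h6) h4 h5
    by_cases hj : r i₀ j
    · rw [if_pos hj] at h6
      have := hbF j hj
      omega
    · rw [if_neg hj] at h6
      rw [if_pos hi] at h1
      exact H.cut j m i n h6 hna (h1.trans_le (H.le i)) h5.symm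
  -- All trails end at the same vertex, so once a trail of the group is exhausted, the cut contains
  -- all trails completely.
  by_cases hfin : ∃ h, r i₀ h ∧ b h = L h
  · left
    obtain ⟨h, hh, hbh⟩ := hfin
    refine ⟨H.chain, fun s hs => (H.top s hs).trans H.le, fun F hF i n j m hn => ?_⟩
    refine hbase F hF i n j m (hn.trans_le ?_)
    by_contra hlt
    refine hcut h (L h - 1) i (L i - 1) ?_ (by omega) (by have := hL i; omega) (hend h i)
    rw [if_pos hh, hbh]
    have := hL h
    omega
  right
  push Not at hfin
  have hbb : b ≤ fun i => if r i₀ i then b i + 1 else b i := by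
    intro i
    dsimp only
    split_ifs <;> omega
  obtain ⟨hch, htop⟩ := isChain_insert_top H.chain H.top hbb
  -- Each trail of the dissolved group becomes a group of its own, with a window of one vertex.
  refine ⟨fun i => if r i₀ i then b i else a i, fun x y => x = y ∨ (r x y ∧ ¬ r i₀ x),
    insert (fun i => if r i₀ i then b i + 1 else b i) S, ?_⟩
  refine
    { equiv := ⟨fun x => Or.inl rfl, ?_, ?_⟩
      lt := ?_
      le := ?_
      mem := Set.mem_insert _ _
      chain := hch
      top := htop
      cut := hcut
      base := fun F hF => hbase F fun hc => hF (hc.mono (Set.subset_insert _ _))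
      mixed := ?_
      inner := ?_
      fresh := ?_ }
  · rintro x y (rfl | ⟨h1, h2⟩)
    · exact Or.inl rfl
    · exact Or.inr ⟨H.equiv.symm h1, fun h => h2 (H.equiv.trans h (H.equiv.symm h1))⟩
  · rintro x y z (rfl | ⟨h1, h2⟩)
    · exact id
    · rintro (rfl | ⟨h3, h4⟩)
      · exact Or.inr ⟨h1, h2⟩
      · exact Or.inr ⟨H.equiv.trans h1 h3, h2⟩
  · intro i
    have := H.lt i
    split_ifs <;> omega
  · intro i
    have := H.le i
    split_ifs with h
    · have := hfin i h
      omega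
    · omega
  · intro F x y hxy hx hy
    by_cases hix : r i₀ x
    · obtain rfl : x = y := by
        rcases hxy with h | ⟨_, h⟩
        · exact h
        · exact (h hix).elim
      simp only [if_pos hix] at hx hy
      omega
    · have hr : r x y := by
        rcases hxy with rfl | ⟨h, _⟩
        · exact H.equiv.refl _
        · exact h
      have hiy : ¬ r i₀ y := fun h => hix (H.equiv.trans h (H.equiv.symm hr))
      simp only [if_neg hix] at hx
      simp only [if_neg hiy] at hy
      exact (H.mixed F x y hr hx hy).mono (Set.subset_insert _ _)
  · intro i n h m h1 h2 h3 h4 h5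
    by_cases hi : r i₀ i
    · simp only [if_pos hi] at h1 h2
      omega
    · simp only [if_neg hi] at h1 h2
      refine Or.inr ⟨H.inner i n h m h1 h2 (le_trans ?_ h3) h4 h5, hi⟩
      have := H.lt h
      split_ifs <;> omega
  · intro i n h1 h2
    by_cases hi : r i₀ i
    · simp only [if_pos hi] at h1 h2
      have hnL : n < L i := by
        have := hfin i hi
        have := H.le i
        omega
      have hn : (if r i₀ i then b i else a i) ≤ n := by rwa [if_pos hi]
      refine ⟨_, Set.mem_insert _ _, i, n, Or.inl rfl, ⟨by simp only [if_pos hi]; omega, ?_⟩, rfl⟩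
      intro k l hl hkl
      by_contra hlt
      push Not at hlt
      by_cases hk : r i₀ k
      · simp only [if_pos hk] at hlt
        exact hcut k l i n (by rw [if_pos hk]; omega) hn hnL hkl
      · simp only [if_neg hk] at hlt
        by_cases hak : l < a k
        · exact hcut k l i n (by rwa [if_neg hk]) hn hnL hkl
        · have := H.lt i
          exact hk (H.equiv.trans hi (H.equiv.symm
            (H.inner k l i n (not_lt.1 hak) hlt (by omega) hnL hkl)))
    · simp only [if_neg hi] at h1 h2
      obtain ⟨s, hs, i', n', h3, h4⟩ := H.fresh i n h1 h2
      exact ⟨s, Set.mem_insert_of_mem _ hs, i', n', Or.inr ⟨h3, hi⟩, h4⟩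

/-! ### Continuing the sweep until it is complete -/

/-- In a finite type with a relation in which every element has a successor outside its own class,
some set of classes that are mutually reachable from each other can be merged. -/
theorem exists_merged_equivalence [Fintype I] [Nonempty I] {r g : I → I → Prop}
    (hr : Equivalence r) (hg : ∀ i, ∃ j k, r i j ∧ g j k ∧ ¬ r j k) :
    ∃ t : I → I → Prop, Equivalence t ∧ (∀ i j, r i j → t i j) ∧ (∃ i j, t i j ∧ ¬ r i j) ∧
      ∀ (P : I → Prop), (∀ i j, r i j → P i → P j) → ∀ x y, t x y → P x → ¬ P y →
        ∃ i h, P i ∧ ¬ P h ∧ g i h := by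
  classical
  let R : I → I → Prop := Relation.ReflTransGen fun x y => r x y ∨ g x y
  let C : I → Finset I := fun i => Finset.univ.filter (R i)
  -- An element with the fewest reachable elements lies in a terminal strongly connected component,
  -- which becomes one class.
  obtain ⟨i, -, hi⟩ := Finset.exists_min_image Finset.univ (fun i => (C i).card)
    Finset.univ_nonempty
  have hC : ∀ j, R i j → ∀ k, R i k → R j k := by
    intro j hj k hk
    have hsub : C j ⊆ C i := by
      intro x hx
      simp only [C, Finset.mem_filter, Finset.mem_univ, true_and] at hx ⊢
      exact hj.trans hx
    have heq := Finset.eq_of_subset_of_card_le hsub (hi j (Finset.mem_univ _))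
    have : k ∈ C i := by simpa [C] using hk
    rw [← heq] at this
    simpa [C] using this
  have hRr : ∀ x y, R i x → r x y → R i y := fun x y hx hxy => hx.tail (Or.inl hxy)
  refine ⟨fun x y => r x y ∨ (R i x ∧ R i y), ⟨fun x => Or.inl (hr.refl x), ?_, ?_⟩,
    fun x y h => Or.inl h, ?_, ?_⟩
  · rintro x y (h | h)
    · exact Or.inl (hr.symm h)
    · exact Or.inr h.symm
  · rintro x y z (h | ⟨h, h'⟩) (k | ⟨k, k'⟩)
    · exact Or.inl (hr.trans h k)
    · exact Or.inr ⟨hRr _ _ k (hr.symm h), k'⟩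
    · exact Or.inr ⟨h, hRr _ _ h' k⟩
    · exact Or.inr ⟨h, k'⟩
  · obtain ⟨j, k, h1, h2, h3⟩ := hg i
    have hj : R i j := hRr _ _ Relation.ReflTransGen.refl h1
    exact ⟨j, k, Or.inr ⟨hj, hj.tail (Or.inr h2)⟩, h3⟩
  · intro P hP x y hxy hx hy
    rcases hxy with hxy | ⟨h1, h2⟩
    · exact (hy (hP x y hxy hx)).elim
    by_contra hcon
    push Not at hcon
    have hxR : R x y := hC x h1 y h2
    have hPz : ∀ z, R x z → P z := by
      intro z hz
      induction hz with
      | refl => exact hx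
      | tail _ hst ih =>
        rcases hst with hst | hst
        · exact hP _ _ hst ih
        · by_contra hw
          exact hcon _ _ ih hw hst
    exact hy (hPz y hxR)

open Classical in
/-- As long as a sweep is not complete, it can be continued. -/
theorem IsSweep.step [Fintype I] [Nonempty I] {L : I → ℕ} {v : I → ℕ → Q} {a b : I → ℕ}
    {r : I → I → Prop} {S : Set (I → ℕ)} (H : IsSweep L v a b r S) (hL : ∀ i, 0 < L i)
    (hend : ∀ i j, v i (L i - 1) = v j (L j - 1)) :
    (∃ S', IsSwept L v S') ∨ ∃ a' b' r' S', IsSweep L v a' b' r' S' ∧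
      (∑ i, b i < ∑ i, b' i ∨ (b' = b ∧ (Finset.univ.filter fun p : I × I => r p.1 p.2).card <
        (Finset.univ.filter fun p : I × I => r' p.1 p.2).card)) := by
  -- A group whose passed vertices recur beyond `a` only within itself is reset if its state is a
  -- cut, and advanced otherwise. If there is no such group, groups are merged.
  by_cases hout : ∃ j, ∀ i n h m, r j i → a i ≤ n → n < b i → a h ≤ m → m < L h →
      v i n = v h m → r i h
  · obtain ⟨j₀, hout⟩ := hout
    by_cases hcut : ∀ i n j m, n < (if r j₀ i then b i else a i) →
        (if r j₀ j then b j else a j) ≤ m → m < L j → v i n ≠ v j m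
    · rcases H.reset hL hend j₀ hcut with h | ⟨a', r', S', h⟩
      · exact Or.inl ⟨S, h⟩
      · refine Or.inr ⟨a', _, r', S', h, Or.inl ?_⟩
        refine Finset.sum_lt_sum (fun i _ => ?_) ⟨j₀, Finset.mem_univ _, ?_⟩
        · split_ifs <;> omega
        · rw [if_pos (H.equiv.refl _)]
          omega
    · push Not at hcut
      obtain ⟨i, n, j, m, h1, h2, h3, h4⟩ := hcut
      have haj : a j ≤ m := by
        have := H.lt j
        split_ifs at h2 <;> omega
      have hna : a i ≤ n := by
        by_contra hna
        exact H.cut i n j m (not_le.1 hna) haj h3 h4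
      have hi : r j₀ i := by
        by_contra hi
        rw [if_neg hi] at h1
        omega
      rw [if_pos hi] at h1
      have hij : r i j := hout i n j m hi hna h1 haj h3 h4
      have hj : r j₀ j := H.equiv.trans hi hij
      rw [if_pos hj] at h2
      refine Or.inr ⟨_, _, _, _, H.advance (j := j) (fun i n h m hr => hout i n h m
        (H.equiv.trans hj hr)) (H.equiv.symm hij) hna h1 h2 h3 h4, Or.inl ?_⟩
      refine Finset.sum_lt_sum (fun k _ => ?_) ⟨j, Finset.mem_univ _, by simp⟩
      by_cases hk : k = j
      · subst hk; simp
      · simp [hk]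
  · push Not at hout
    obtain ⟨t, ht, hrt, ⟨x, y, hxy, hxy'⟩, hP⟩ := exists_merged_equivalence
      (g := fun i h => ∃ n m, a i ≤ n ∧ n < b i ∧ a h ≤ m ∧ m < L h ∧ v i n = v h m) H.equiv
      (fun j => by
        obtain ⟨i, n, h, m, h1, h2, h3, h4, h5, h6, h7⟩ := hout j
        exact ⟨i, h, h1, ⟨n, m, h2, h3, h4, h5, h6⟩, h7⟩)
    refine Or.inr ⟨a, b, t, S, H.merge ht hrt ?_, Or.inr ⟨rfl, Finset.card_lt_card ?_⟩⟩
    · intro P hPr x y hxy hx hy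
      obtain ⟨i, h, hi, hh, n, m, h1⟩ := hP P hPr x y hxy hx hy
      exact ⟨i, n, h, m, hi, hh, h1⟩
    · refine Finset.ssubset_iff_subset_ne.2 ⟨fun p hp => ?_, fun he => hxy' ?_⟩
      · simp only [Finset.mem_filter, Finset.mem_univ, true_and] at hp ⊢
        exact hrt _ _ hp
      · have : (x, y) ∈ Finset.univ.filter fun p : I × I => t p.1 p.2 := by simpa using hxy
        rw [← he] at this
        simpa using this

/-- A step raises `∑ b`, which is at most `∑ L`, or keeps `b` and adds pairs to `r`, which has at
most `N`. The weight `(N + 1) * ∑ b + #r` is therefore bounded and grows with every step. -/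
theorem exists_isSwept [Fintype I] [Nonempty I] (L : I → ℕ) (v : I → ℕ → Q) (hL : ∀ i, 0 < L i)
    (hend : ∀ i j, v i (L i - 1) = v j (L j - 1)) : ∃ S, IsSwept L v S := by
  classical
  by_contra hcon
  set N := Fintype.card (I × I) with hN
  have hcard : ∀ r : I → I → Prop, (Finset.univ.filter fun p : I × I => r p.1 p.2).card ≤ N :=
    fun r => Finset.card_le_univ _
  have key : ∀ K : ℕ, ∃ a b r S, IsSweep L v a b r S ∧
      K ≤ (N + 1) * ∑ i, b i + (Finset.univ.filter fun p : I × I => r p.1 p.2).card := by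
    intro K
    induction K with
    | zero => exact ⟨_, _, _, _, isSweep_init hL, Nat.zero_le _⟩
    | succ K ih =>
      obtain ⟨a, b, r, S, H, hK⟩ := ih
      rcases H.step hL hend with h | ⟨a', b', r', S', H', h | ⟨rfl, h⟩⟩
      · exact (hcon h).elim
      · refine ⟨a', b', r', S', H', ?_⟩
        have h1 := hcard r
        have h2 : (N + 1) * (∑ i, b i + 1) ≤ (N + 1) * ∑ i, b' i := Nat.mul_le_mul_left _ h
        rw [Nat.mul_add] at h2
        omega
      · exact ⟨a', b', r', S', H', by omega⟩
  obtain ⟨a, b, r, S, H, hK⟩ := key ((N + 1) * ∑ i, L i + N + 1)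
  have h1 := hcard r
  have h2 : (N + 1) * ∑ i, b i ≤ (N + 1) * ∑ i, L i :=
    Nat.mul_le_mul_left _ (Finset.sum_le_sum fun i _ => H.le i)
  omega

/-- Trails from a common start to a common end can be ranked in such a way that switching at fresh
positions increases the rank, and suffices to avoid every cut of the trails that does not separate
the start from the end. -/
theorem exists_switching_rank [Fintype I] [Nonempty I] (L : I → ℕ) (v : I → ℕ → Q)
    (hL : ∀ i, 0 < L i) (hend : ∀ i j, v i (L i - 1) = v j (L j - 1)) :
    ∃ (A : I → ℕ → Prop) (ρ : I → ℕ → ℕ), (∀ i n, n + 1 < L i → ρ i n < ρ i (n + 1)) ∧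
      (∀ i n k l, A i (n + 1) → l < L k → v k l = v i (n + 1) → ρ i n < ρ k l) ∧
      (∀ i n, A i n → n < L i) ∧
      ∀ F : I → ℕ, (∀ i n, A i n → n < F i → ∀ j m, F j ≤ m → m < L j → v j m ≠ v i n) →
        ∀ i n j m, n < L i → n < F i → F j ≤ m → m < L j → v i n ≠ v j m := by
  classical
  obtain ⟨S, hch, hle, hS⟩ := exists_isSwept L v hL hend
  have hfin : S.Finite := (Set.finite_Iic L).subset fun s hs => hle s hs
  set M := ∑ i, L i + 1 with hM
  have hLM : ∀ i, L i < M := fun i => by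
    have := Finset.single_le_sum (f := L) (fun _ _ => Nat.zero_le _) (Finset.mem_univ i)
    omega
  -- `τ i n` counts the states that have not taken trail `i` beyond position `n`; the factor `M`
  -- lets it dominate the position.
  let τ : I → ℕ → ℕ := fun i n => (hfin.toFinset.filter fun b => b i ≤ n + 1).card
  refine ⟨fun i n => ∃ b ∈ S, FreshAt L v b i n, fun i n => M * τ i n + n, ?_, ?_, ?_, ?_⟩
  · intro i n _
    have : τ i n ≤ τ i (n + 1) := Finset.card_le_card fun b hb => by
      simp only [Finset.mem_filter] at hb ⊢
      exact ⟨hb.1, by omega⟩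
    have := Nat.mul_le_mul_left M this
    dsimp only
    omega
  · rintro i n k l ⟨b, hb, h1, h2⟩ hl hkl
    have hb' := hle b hb i
    -- States counted at `(i, n)` precede `b` in the chain and so are counted at `(k, l)`; `b`
    -- itself is counted only there.
    have : τ i n < τ k l := by
      refine Finset.card_lt_card (Finset.ssubset_iff_subset_ne.2 ⟨fun s hs => ?_, fun he => ?_⟩)
      · simp only [Finset.mem_filter, Set.Finite.mem_toFinset] at hs ⊢
        refine ⟨hs.1, ?_⟩
        rcases hch.total hs.1 hb with h | h
        · exact (h k).trans (h2 k l hl hkl)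
        · have : b i ≤ s i := h i
          omega
      · have : b ∈ hfin.toFinset.filter fun b => b k ≤ l + 1 := by
          simp only [Finset.mem_filter, Set.Finite.mem_toFinset]
          exact ⟨hb, h2 k l hl hkl⟩
        rw [← he] at this
        simp only [Finset.mem_filter] at this
        omega
    have h3 := Nat.mul_le_mul_left M (Nat.succ_le_of_lt this)
    rw [Nat.succ_eq_add_one, Nat.mul_add] at h3
    have h4 := hLM i
    have h5 : b i ≤ L i := hb'
    show M * τ i n + n < M * τ k l + l
    omega
  · rintro i n ⟨b, hb, h1, -⟩
    have : b i ≤ L i := hle b hb i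
    omega
  · intro F hF
    refine hS F ?_
    rintro ⟨b, hb, i, n, h1, h2, j, m, h3, h4, h5⟩
    exact hF i n ⟨b, hb, h1⟩ h2 j m h3 h4 h5

end Sweep

/-! ### Edge-disjoint paths -/

section Menger

variable {V : Type*} {G : SimpleGraph V}

/-- The unit flow along a walk. -/
def walkFlow [DecidableEq V] {a b : V} : G.Walk a b → V → V → ℤ
  | .nil => fun _ _ => 0
  | .cons (u := x) (v := y) _ p => fun u v =>
      (if u = x ∧ v = y then 1 else 0) - (if u = y ∧ v = x then 1 else 0) + walkFlow p u v

theorem walkFlow_antisymm [DecidableEq V] {a b : V} (p : G.Walk a b) (u v : V) :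
    walkFlow p u v = -walkFlow p v u := by
  induction p with
  | nil => simp [walkFlow]
  | cons h p ih =>
    simp only [walkFlow, ih, and_comm]
    ring

theorem walkFlow_eq_zero [DecidableEq V] {a b : V} (p : G.Walk a b) {u v : V}
    (h : s(u, v) ∉ p.edges) : walkFlow p u v = 0 := by
  induction p with
  | nil => simp [walkFlow]
  | @cons x y z hxy p ih =>
    simp only [SimpleGraph.Walk.edges_cons, List.mem_cons, not_or] at h
    have h1 : ¬ (u = x ∧ v = y) := by
      rintro ⟨rfl, rfl⟩
      exact h.1 rfl
    have h2 : ¬ (u = y ∧ v = x) := by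
      rintro ⟨rfl, rfl⟩
      exact h.1 Sym2.eq_swap
    simp only [walkFlow, if_neg h1, if_neg h2, ih h.2]
    ring

theorem walkFlow_eq_one [DecidableEq V] {a b : V} (p : G.Walk a b) (hp : p.IsTrail) {d : G.Dart}
    (hd : d ∈ p.darts) : walkFlow p d.fst d.snd = 1 := by
  induction p with
  | nil => simp at hd
  | @cons x y z hxy p ih =>
    rw [SimpleGraph.Walk.isTrail_cons] at hp
    rw [SimpleGraph.Walk.darts_cons, List.mem_cons] at hd
    rcases hd with rfl | hd
    · have h2 : ¬ (x = y ∧ y = x) := fun h => hxy.ne h.1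
      simp only [walkFlow, and_self, if_true, if_neg h2, walkFlow_eq_zero p hp.2]
      ring
    · have hne : s(d.fst, d.snd) ≠ s(x, y) := by
        intro h
        refine hp.2 (h ▸ ?_)
        exact List.mem_map.2 ⟨d, hd, rfl⟩
      have h1 : ¬ (d.fst = x ∧ d.snd = y) := by
        rintro ⟨h1, h2⟩
        exact hne (by rw [h1, h2])
      have h2 : ¬ (d.fst = y ∧ d.snd = x) := by
        rintro ⟨h1, h2⟩
        exact hne (by rw [h1, h2, Sym2.eq_swap])
      simp only [walkFlow, if_neg h1, if_neg h2, ih hp.1 hd]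
      ring

theorem sum_walkFlow [DecidableEq V] [Fintype V] {a b : V} (p : G.Walk a b) (u : V) :
    ∑ v, walkFlow p u v = (if u = a then 1 else 0) - (if u = b then 1 else 0) := by
  induction p with
  | nil => simp [walkFlow]
  | @cons x y z hxy p ih =>
    simp only [walkFlow, Finset.sum_add_distrib, Finset.sum_sub_distrib, ih, ite_and,
      Finset.sum_ite_irrel, Finset.sum_ite_eq', Finset.sum_const_zero, Finset.mem_univ, if_true]
    ring

variable {s r : V}

theorem dart_mem_or_of_mem_edges {a b : V} {p : G.Walk a b} {u v : V} (h : s(u, v) ∈ p.edges) :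
    (∃ d ∈ p.darts, d.fst = u ∧ d.snd = v) ∨ ∃ d ∈ p.darts, d.fst = v ∧ d.snd = u := by
  obtain ⟨d, hd, he⟩ := List.mem_map.1 h
  rcases SimpleGraph.dart_edge_eq_mk'_iff'.1 he with h | h
  · exact Or.inl ⟨d, hd, h⟩
  · exact Or.inr ⟨d, hd, h⟩

theorem edgeConnectivity_le_card {F : Finset (Sym2 V)} (hF : IsEdgeCut G s r F) :
    edgeConnectivity G s r ≤ F.card :=
  Nat.sInf_le ⟨F, hF, rfl⟩

theorem not_reachable_of_closed {H : SimpleGraph V} {P : V → Prop} (hs : P s) (hr : ¬ P r)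
    (hP : ∀ u v, H.Adj u v → P u → P v) : ¬ H.Reachable s r := by
  rintro ⟨p⟩
  refine hr ?_
  clear hr
  induction p with
  | nil => exact hs
  | cons h p ih => exact ih (hP _ _ h hs)

/-! ### Unit flows, augmentation and decomposition into paths -/

/-- An integral flow of value `k` from `s` to `r` with unit capacities. -/
structure IsUnitFlow [Fintype V] [DecidableEq V] (G : SimpleGraph V) (s r : V) (k : ℕ)
    (f : V → V → ℤ) : Prop where
  antisymm : ∀ u v, f u v = -f v u
  adj : ∀ u v, ¬ G.Adj u v → f u v = 0
  le_one : ∀ u v, f u v ≤ 1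
  sum_eq : ∀ u, ∑ v, f u v = k * ((if u = s then 1 else 0) - (if u = r then 1 else 0))

variable [Fintype V] [DecidableEq V]

/-- A dart with `f ≤ 0` has residual capacity, and a path uses each edge at most once, so one more
unit fits. -/
theorem IsUnitFlow.add {k : ℕ} {f : V → V → ℤ} (hf : IsUnitFlow G s r k f) (p : G.Walk s r)
    (hp : p.IsPath) (hd : ∀ d ∈ p.darts, f d.fst d.snd ≤ 0) :
    IsUnitFlow G s r (k + 1) fun u v => f u v + walkFlow p u v where
  antisymm u v := by
    rw [hf.antisymm, walkFlow_antisymm]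
    ring
  adj u v h := by
    rw [hf.adj u v h, walkFlow_eq_zero p fun he => h (p.adj_of_mem_edges he), add_zero]
  le_one u v := by
    by_cases he : s(u, v) ∈ p.edges
    · rcases dart_mem_or_of_mem_edges he with ⟨d, hd', rfl, rfl⟩ | ⟨d, hd', rfl, rfl⟩
      · have := hd d hd'
        rw [walkFlow_eq_one p hp.isTrail hd']
        omega
      · have := hf.le_one d.snd d.fst
        rw [walkFlow_antisymm, walkFlow_eq_one p hp.isTrail hd']
        omega
    · rw [walkFlow_eq_zero p he, add_zero]
      exact hf.le_one u v
  sum_eq u := by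
    rw [Finset.sum_add_distrib, hf.sum_eq, sum_walkFlow]
    push_cast
    ring

/-- No flow remains on the edges of the removed path, so paths extracted later are edge-disjoint
from it. -/
theorem IsUnitFlow.sub {k : ℕ} {f : V → V → ℤ} (hf : IsUnitFlow G s r (k + 1) f) (p : G.Walk s r)
    (hp : p.IsPath) (hd : ∀ d ∈ p.darts, f d.fst d.snd = 1) :
    IsUnitFlow G s r k (fun u v => f u v - walkFlow p u v) ∧
      ∀ u v, f u v - walkFlow p u v = 1 → f u v = 1 ∧ s(u, v) ∉ p.edges := by
  have key : ∀ u v, s(u, v) ∈ p.edges → f u v - walkFlow p u v = 0 := by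
    intro u v he
    rcases dart_mem_or_of_mem_edges he with ⟨d, hd', rfl, rfl⟩ | ⟨d, hd', rfl, rfl⟩
    · rw [hd d hd', walkFlow_eq_one p hp.isTrail hd', sub_self]
    · rw [hf.antisymm, walkFlow_antisymm, hd d hd', walkFlow_eq_one p hp.isTrail hd', sub_self]
  refine ⟨⟨?_, ?_, ?_, ?_⟩, ?_⟩
  · intro u v
    rw [hf.antisymm, walkFlow_antisymm]
    ring
  · intro u v h
    rw [hf.adj u v h, walkFlow_eq_zero p fun he => h (p.adj_of_mem_edges he), sub_zero]
  · intro u v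
    by_cases he : s(u, v) ∈ p.edges
    · rw [key u v he]
      exact zero_le_one
    · rw [walkFlow_eq_zero p he, sub_zero]
      exact hf.le_one u v
  · intro u
    rw [Finset.sum_sub_distrib, hf.sum_eq, sum_walkFlow]
    push_cast
    ring
  · intro u v h
    by_cases he : s(u, v) ∈ p.edges
    · rw [key u v he] at h
      exact absurd h zero_ne_one
    · rw [walkFlow_eq_zero p he, sub_zero] at h
      exact ⟨h, he⟩

/-- Either there is a path all of whose darts satisfy `R`, or a set separates its ends. -/
theorem exists_path_or_closed_set (G : SimpleGraph V) (s r : V) (R : V → V → Prop) :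
    (∃ p : G.Walk s r, p.IsPath ∧ ∀ d ∈ p.darts, R d.fst d.snd) ∨
      ∃ S : Finset V, s ∈ S ∧ r ∉ S ∧ ∀ u ∈ S, ∀ v ∉ S, G.Adj u v → ¬ R u v := by
  classical
  let S : Finset V := Finset.univ.filter fun v =>
    ∃ p : G.Walk s v, ∀ d ∈ p.darts, R d.fst d.snd
  have hS : ∀ v, v ∈ S ↔ ∃ p : G.Walk s v, ∀ d ∈ p.darts, R d.fst d.snd := by simp [S]
  by_cases hr : r ∈ S
  · obtain ⟨p, hp⟩ := (hS r).1 hr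
    exact Or.inl ⟨p.bypass, p.bypass_isPath, fun d hd => hp d (p.darts_bypass_subset_darts hd)⟩
  · refine Or.inr ⟨S, (hS s).2 ⟨.nil, by simp⟩, hr, fun u hu v hv h hR => hv ?_⟩
    obtain ⟨p, hp⟩ := (hS u).1 hu
    refine (hS v).2 ⟨p.concat h, fun d hd => ?_⟩
    rw [SimpleGraph.Walk.darts_concat, List.concat_eq_append, List.mem_append,
      List.mem_singleton] at hd
    rcases hd with hd | rfl
    · exact hp d hd
    · exact hR

/-- By antisymmetry the flow inside `S` cancels. -/
theorem IsUnitFlow.sum_boundary {k : ℕ} {f : V → V → ℤ} (hf : IsUnitFlow G s r k f) {S : Finset V}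
    (hs : s ∈ S) (hr : r ∉ S) : ∑ u ∈ S, ∑ v ∈ Sᶜ, f u v = k := by
  have h1 : ∑ u ∈ S, ∑ v, f u v = k := by
    simp_rw [hf.sum_eq, ← Finset.mul_sum, Finset.sum_sub_distrib, Finset.sum_ite_eq', if_pos hs,
      if_neg hr]
    ring
  have h2 : ∑ u ∈ S, ∑ v ∈ S, f u v = 0 := by
    have h3 : ∑ u ∈ S, ∑ v ∈ S, f u v = -∑ u ∈ S, ∑ v ∈ S, f u v := by
      conv_lhs => rw [Finset.sum_comm]
      simp_rw [← Finset.sum_neg_distrib]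
      exact Finset.sum_congr rfl fun u _ => Finset.sum_congr rfl fun v _ => hf.antisymm v u
    omega
  rw [← h1, ← zero_add (∑ u ∈ S, ∑ v ∈ Sᶜ, f u v), ← h2, ← Finset.sum_add_distrib]
  exact Finset.sum_congr rfl fun u _ => Finset.sum_add_sum_compl S _

/-- Augmenting paths: if there is none, the boundary of the residually reachable set consists of `k`
saturated edges, a cut smaller than the edge connectivity. -/
theorem exists_isUnitFlow (k : ℕ) (hk : k ≤ edgeConnectivity G s r) :
    ∃ f, IsUnitFlow G s r k f := by
  classical
  induction k with
  | zero => exact ⟨fun _ _ => 0, ⟨by simp, by simp, by simp, by simp⟩⟩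
  | succ k ih =>
    obtain ⟨f, hf⟩ := ih (by omega)
    rcases exists_path_or_closed_set G s r (fun u v => f u v ≤ 0) with ⟨p, hp, hd⟩ | ⟨S, hs, hr, hS⟩
    · exact ⟨_, hf.add p hp hd⟩
    exfalso
    have hval : ∀ u ∈ S, ∀ v ∈ Sᶜ, f u v = if G.Adj u v then 1 else 0 := by
      intro u hu v hv
      split_ifs with h
      · have h1 := hS u hu v (Finset.mem_compl.1 hv) h
        have h2 := hf.le_one u v
        omega
      · exact hf.adj u v h
    set E := (S ×ˢ Sᶜ).filter fun x : V × V => G.Adj x.1 x.2 with hE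
    have hcard : E.card = k := by
      have h1 := hf.sum_boundary hs hr
      rw [Finset.sum_congr rfl fun u hu => Finset.sum_congr rfl (hval u hu),
        ← Finset.sum_product' (f := fun u v => if G.Adj u v then (1 : ℤ) else 0),
        Finset.sum_boole] at h1
      exact_mod_cast h1
    have hcut : IsEdgeCut G s r (E.image fun x => s(x.1, x.2)) := by
      refine ⟨?_, not_reachable_of_closed (P := (· ∈ S)) hs hr ?_⟩
      · intro e he
        simp only [Finset.coe_image, Set.mem_image, Finset.mem_coe, hE, Finset.mem_filter] at he
        obtain ⟨x, ⟨-, hx⟩, rfl⟩ := he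
        exact hx
      · intro u v huv hu
        by_contra hv
        rw [SimpleGraph.deleteEdges_adj] at huv
        refine huv.2 ?_
        simp only [Finset.coe_image, Set.mem_image, Finset.mem_coe]
        refine ⟨(u, v), ?_, rfl⟩
        simp [hE, hu, hv, huv.1]
    have h1 := edgeConnectivity_le_card hcut
    have h2 := Finset.card_image_le (s := E) (f := fun x : V × V => s(x.1, x.2))
    omega

/-- Positive net flow across every `s,r` boundary forces a path of darts with flow one; it is peeled
off. -/
theorem IsUnitFlow.exists_paths {k : ℕ} {f : V → V → ℤ} (hf : IsUnitFlow G s r k f) :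
    ∃ P : Fin k → G.Walk s r, (∀ i, (P i).IsPath) ∧
      (∀ i j, i ≠ j → ∀ e ∈ (P i).edges, e ∉ (P j).edges) ∧
      ∀ i, ∀ d ∈ (P i).darts, f d.fst d.snd = 1 := by
  induction k generalizing f with
  | zero => exact ⟨fun i => i.elim0, fun i => i.elim0, fun i => i.elim0, fun i => i.elim0⟩
  | succ k ih =>
    rcases exists_path_or_closed_set G s r (fun u v => f u v = 1) with ⟨p, hp, hd⟩ | ⟨S, hs, hr, hS⟩
    · obtain ⟨hf', hsub⟩ := hf.sub p hp hd
      obtain ⟨P, h1, h2, h3⟩ := ih hf'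
      have hdis : ∀ i, ∀ e ∈ (P i).edges, e ∉ p.edges := by
        intro i e he
        obtain ⟨d, hd, rfl⟩ := List.mem_map.1 he
        exact (hsub _ _ (h3 i d hd)).2
      refine ⟨Fin.cons p P, ?_, ?_, ?_⟩
      · exact Fin.cases hp h1
      · refine Fin.cases ?_ fun i => ?_
        · refine Fin.cases (fun h => (h rfl).elim) fun j _ e he he' => hdis j e he' he
        · refine Fin.cases (fun _ e he => hdis i e he) fun j hij e he => ?_
          exact h2 i j (fun h => hij (by rw [h])) e he
      · exact Fin.cases hd fun i d hd' => (hsub _ _ (h3 i d hd')).1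
    · exfalso
      have h1 := hf.sum_boundary hs hr
      have h2 : ∑ u ∈ S, ∑ v ∈ Sᶜ, f u v ≤ 0 := by
        refine Finset.sum_nonpos fun u hu => Finset.sum_nonpos fun v hv => ?_
        by_cases h : G.Adj u v
        · have h3 := hS u hu v (Finset.mem_compl.1 hv) h
          have h4 := hf.le_one u v
          omega
        · exact (hf.adj u v h).le
      push_cast at h1
      omega

/-- Menger's theorem for edge-disjoint paths in a graph. -/
theorem exists_edge_disjoint_paths (G : SimpleGraph V) (s r : V) :
    ∃ P : Fin (edgeConnectivity G s r) → G.Walk s r, (∀ i, (P i).IsPath) ∧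
      ∀ i j, i ≠ j → ∀ e ∈ (P i).edges, e ∉ (P j).edges := by
  obtain ⟨f, hf⟩ := exists_isUnitFlow (G := G) (s := s) (r := r) _ le_rfl
  obtain ⟨P, h1, h2, -⟩ := hf.exists_paths
  exact ⟨P, h1, h2⟩

end Menger

/-! ### The switching protocol -/

section Protocol

variable {V : Type*} {G : SimpleGraph V}

theorem mem_edges_iff_exists_getVert {a b : V} {p : G.Walk a b} {e : Sym2 V} :
    e ∈ p.edges ↔ ∃ n < p.length, e = s(p.getVert n, p.getVert (n + 1)) := by
  induction e with
  | _ u v =>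
    rw [SimpleGraph.Walk.mk_mem_edges_iff_exists]
    exact exists_congr fun n => and_congr_right fun _ => eq_comm

theorem isProtocolWalk_append {A : Set (V × V × V)} {a b c : V} {p : G.Walk a b} {q : G.Walk b c}
    (hp : IsProtocolWalk A p) (hq : IsProtocolWalk A q)
    (hpq : 0 < p.length → 0 < q.length → (p.getVert (p.length - 1), b, q.getVert 1) ∈ A) :
    IsProtocolWalk A (p.append q) := by
  intro i hi
  rw [SimpleGraph.Walk.length_append] at hi
  have key : ∀ k, p.length ≤ k → (p.append q).getVert k = q.getVert (k - p.length) := by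
    intro k hk
    rw [SimpleGraph.Walk.getVert_append, if_neg (not_lt.2 hk)]
  have key' : ∀ k, k ≤ p.length → (p.append q).getVert k = p.getVert k := by
    intro k hk
    rcases hk.lt_or_eq with h | rfl
    · rw [SimpleGraph.Walk.getVert_append, if_pos h]
    · rw [key _ le_rfl, Nat.sub_self, SimpleGraph.Walk.getVert_zero,
        SimpleGraph.Walk.getVert_length]
  rcases lt_trichotomy (i + 1) p.length with h | h | h
  · rw [key' _ (by omega), key' _ (by omega), key' _ (by omega)]
    exact hp i (by omega)
  · rw [key' _ (by omega), key' _ (by omega), key _ (by omega), h, SimpleGraph.Walk.getVert_length]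
    have := hpq (by omega) (by omega)
    rwa [show p.length - 1 = i by omega, show 1 = i + 2 - p.length by omega] at this
  · rw [key _ (by omega), key _ (by omega), key _ (by omega)]
    have := hq (i - p.length) (by omega)
    rwa [show i - p.length + 1 = i + 1 - p.length by omega,
      show i - p.length + 2 = i + 2 - p.length by omega] at this

/-- A walk in a forest without backtracking is a path: a neighbour of the end of a path that lies on
this path is the penultimate vertex. -/
theorem SimpleGraph.IsAcyclic.ne_of_not_backtracking {T : SimpleGraph V} (hT : T.IsAcyclic)
    (g : ℕ → V) (n : ℕ) (hadj : ∀ k ≤ n, T.Adj (g k) (g (k + 1)))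
    (hne : ∀ k < n, g k ≠ g (k + 2)) : g 0 ≠ g (n + 1) := by
  have key : ∃ p : T.Walk (g 0) (g (n + 1)), p.IsPath ∧ 0 < p.length ∧ p.penultimate = g n := by
    induction n with
    | zero =>
      have h := hadj 0 le_rfl
      exact ⟨.cons h .nil, by simpa using h.ne, by simp, by simp⟩
    | succ n ih =>
      obtain ⟨p, hp, -, hpen⟩ := ih (fun k hk => hadj k (by omega)) fun k hk => hne k (by omega)
      have h := hadj (n + 1) le_rfl
      refine ⟨p.concat h, hp.concat (fun hmem => hne n (Nat.lt_succ_self n) ?_) h, by simp, by simp⟩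
      rw [← hpen]
      exact (hT.eq_penultimate_of_adj_end hp h hmem).symm
  obtain ⟨p, hp, hlen, -⟩ := key
  intro h
  have := hp.getVert_injOn (x₁ := 0) (x₂ := p.length) (by simp) (by simp) (by simpa using h)
  omega

variable {s r : V} {I : Type*}

/-- The protocol to follow the paths `P`, to enter the forest `T` or another path at a position in
`A`, and to leave the forest `T` anywhere. -/
def switchProtocol (P : I → G.Walk s r) (T : SimpleGraph V) (A : I → ℕ → Prop) :
    Set (V × V × V) :=
  {t | IsInstruction G t ∧
    ((∃ i n, n + 2 ≤ (P i).length ∧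
      t = ((P i).getVert n, (P i).getVert (n + 1), (P i).getVert (n + 2))) ∨
    ((T.Adj t.1 t.2.1 ∨ ∃ i n, n < (P i).length ∧ A i (n + 1) ∧ t.1 = (P i).getVert n ∧
        t.2.1 = (P i).getVert (n + 1)) ∧
      (T.Adj t.2.1 t.2.2 ∨ ∃ j m, m < (P j).length ∧ t.2.1 = (P j).getVert m ∧
        t.2.2 = (P j).getVert (m + 1))))}

open Classical in
/-- A rank which does not decrease along the walks of a switching protocol. -/
noncomputable def dartRank (P : I → G.Walk s r) (T : SimpleGraph V) (ρ : I → ℕ → ℕ) (u v : V) : ℕ :=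
  if h : ∃ x : I × ℕ, x.2 < (P x.1).length ∧ u = (P x.1).getVert x.2 ∧
      v = (P x.1).getVert (x.2 + 1) then
    2 * ρ h.choose.1 h.choose.2 + 1
  -- A forest dart gets twice the least rank of a path position in its component, so leaving the
  -- component raises the rank strictly even at that position. A component that meets no path gets
  -- the default `0`; no instruction of the protocol joins its darts to path darts.
  else 2 * sInf {k | ∃ j m, m < (P j).length + 1 ∧
    T.connectedComponentMk ((P j).getVert m) = T.connectedComponentMk u ∧ ρ j m = k}

variable {P : I → G.Walk s r} (hP : ∀ i, (P i).IsPath)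
  (hdis : ∀ i j, i ≠ j → ∀ e ∈ (P i).edges, e ∉ (P j).edges)

include hP hdis in
theorem edge_injective {i j : I} {n m : ℕ} (hn : n < (P i).length) (hm : m < (P j).length)
    (h : s((P i).getVert n, (P i).getVert (n + 1)) = s((P j).getVert m, (P j).getVert (m + 1))) :
    i = j ∧ n = m := by
  have hij : i = j := by
    by_contra hij
    exact hdis i j hij _ (mem_edges_iff_exists_getVert.2 ⟨n, hn, rfl⟩)
      (mem_edges_iff_exists_getVert.2 ⟨m, hm, h⟩)
  subst hij
  refine ⟨rfl, ?_⟩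
  have hn' : n < (P i).edges.length := by simpa using hn
  have hm' : m < (P i).edges.length := by simpa using hm
  rw [← SimpleGraph.Walk.getElem_edges hn', ← SimpleGraph.Walk.getElem_edges hm'] at h
  exact ((hP i).isTrail.edges_nodup.getElem_inj_iff).1 h

variable {T : SimpleGraph V} (hT : ∀ i, ∀ e ∈ (P i).edges, e ∉ T.edgeSet)

include hP hdis in
theorem dartRank_path (ρ : I → ℕ → ℕ) {i : I} {n : ℕ} (hn : n < (P i).length) :
    dartRank P T ρ ((P i).getVert n) ((P i).getVert (n + 1)) = 2 * ρ i n + 1 := by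
  have h : ∃ x : I × ℕ, x.2 < (P x.1).length ∧ (P i).getVert n = (P x.1).getVert x.2 ∧
      (P i).getVert (n + 1) = (P x.1).getVert (x.2 + 1) := ⟨(i, n), hn, rfl, rfl⟩
  obtain ⟨h1, h2, h3⟩ := h.choose_spec
  obtain ⟨h4, h5⟩ := edge_injective hP hdis hn h1 (congrArg₂ (fun a b => s(a, b)) h2 h3)
  rw [dartRank, dif_pos h, ← h4, ← h5]

include hT in
theorem dartRank_forest (ρ : I → ℕ → ℕ) {u v : V} (huv : T.Adj u v) :
    dartRank P T ρ u v = 2 * sInf {k | ∃ j m, m < (P j).length + 1 ∧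
      T.connectedComponentMk ((P j).getVert m) = T.connectedComponentMk u ∧ ρ j m = k} := by
  rw [dartRank, dif_neg]
  rintro ⟨x, h1, rfl, rfl⟩
  exact hT x.1 _ (mem_edges_iff_exists_getVert.2 ⟨x.2, h1, rfl⟩) huv

variable {A : I → ℕ → Prop} {ρ : I → ℕ → ℕ}
  (h₁ : ∀ i n, n + 1 < (P i).length + 1 → ρ i n < ρ i (n + 1))
  (h₂ : ∀ i n k l, A i (n + 1) → l < (P k).length + 1 →
    T.connectedComponentMk ((P k).getVert l) = T.connectedComponentMk ((P i).getVert (n + 1)) →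
    ρ i n < ρ k l)

include hP hdis hT h₁ h₂ in
theorem dartRank_le {u v w : V} (h : (u, v, w) ∈ switchProtocol P T A) :
    dartRank P T ρ u v < dartRank P T ρ v w ∨
      (dartRank P T ρ u v = dartRank P T ρ v w ∧ T.Adj u v ∧ T.Adj v w) := by
  obtain ⟨-, ⟨i, n, hn, heq⟩ | ⟨h | ⟨i, n, hn, hA, h, h'⟩, k | ⟨j, m, hm, k, k'⟩⟩⟩ := h
  · obtain ⟨rfl, rfl, rfl⟩ : u = (P i).getVert n ∧ v = (P i).getVert (n + 1) ∧
        w = (P i).getVert (n + 2) := by simpa using heq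
    left
    rw [dartRank_path hP hdis ρ (by omega), dartRank_path hP hdis ρ (by omega)]
    have := h₁ i n (by omega)
    omega
  · right
    refine ⟨?_, h, k⟩
    rw [dartRank_forest hT ρ h, dartRank_forest hT ρ k,
      SimpleGraph.ConnectedComponent.eq.2 h.reachable]
  · dsimp only at h k k'
    subst k k'
    left
    rw [dartRank_forest hT ρ h, dartRank_path hP hdis ρ hm]
    have := Nat.sInf_le (s := {k | ∃ j' m', m' < (P j').length + 1 ∧
      T.connectedComponentMk ((P j').getVert m') = T.connectedComponentMk u ∧ ρ j' m' = k})
      ⟨j, m, by omega, SimpleGraph.ConnectedComponent.eq.2 h.reachable.symm, rfl⟩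
    omega
  · dsimp only at h h' k
    subst h h'
    left
    rw [dartRank_forest hT ρ k, dartRank_path hP hdis ρ hn]
    obtain ⟨j, m, hm, hc, heq⟩ := Nat.sInf_mem (s := {k | ∃ j' m', m' < (P j').length + 1 ∧
      T.connectedComponentMk ((P j').getVert m') =
        T.connectedComponentMk ((P i).getVert (n + 1)) ∧ ρ j' m' = k})
      ⟨_, i, n + 1, by omega, rfl, rfl⟩
    have := h₂ i n j m hA hm hc
    omega
  · dsimp only at h h' k k'
    subst h h' k'
    left
    rw [dartRank_path hP hdis ρ hn, k, dartRank_path hP hdis ρ hm]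
    have := h₂ i n j m hA (by omega) (by rw [k])
    omega

-- No walk repeats a dart: between two passages the rank would be constant, so by `dartRank_le` that
-- part would be a closed walk in the forest without backtracking.
include hP hdis hT h₁ h₂ in
theorem switchProtocol_finite [Fintype V] (hac : T.IsAcyclic) :
    IsFiniteProtocol G s r (switchProtocol P T A) := by
  classical
  refine ⟨fun t ht => ht.1, ?_⟩
  have hfin : {W : G.Walk s r | W.length < Fintype.card (V × V) + 1}.Finite := Set.toFinite _
  refine hfin.subset fun W hW => ?_
  have hinj : Function.Injective fun k : Fin W.length => (W.getVert k, W.getVert (k + 1)) := by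
    have key : ∀ i j, i < j → j < W.length → W.getVert i = W.getVert j →
        W.getVert (i + 1) ≠ W.getVert (j + 1) := by
      intro i j hij hj h h'
      set R : ℕ → ℕ := fun k => dartRank P T ρ (W.getVert k) (W.getVert (k + 1)) with hR
      have hstep : ∀ k, k + 2 ≤ W.length → R k < R (k + 1) ∨ (R k = R (k + 1) ∧
          T.Adj (W.getVert k) (W.getVert (k + 1)) ∧
          T.Adj (W.getVert (k + 1)) (W.getVert (k + 2))) :=
        fun k hk => dartRank_le hP hdis hT h₁ h₂ (hW k hk)
      have hmono : ∀ k l, k ≤ l → l < W.length → R k ≤ R l := by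
        intro k l hkl
        induction l, hkl using Nat.le_induction with
        | base => exact fun _ => le_rfl
        | succ l hkl ih =>
          intro hl
          have h1 := ih (by omega)
          rcases hstep l (by omega) with h2 | h2 <;> omega
      have hRij : R i = R j := by
        simp only [hR, h, h']
      have hadj : ∀ k, i ≤ k → k < j → T.Adj (W.getVert k) (W.getVert (k + 1)) := by
        intro k hik hkj
        have h1 := hmono i k hik (by omega)
        have h2 := hmono (k + 1) j (by omega) hj
        rcases hstep k (by omega) with h3 | h3
        · omega
        · exact h3.2.1
      obtain ⟨d, rfl⟩ : ∃ d, j = i + (d + 1) := ⟨j - i - 1, by omega⟩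
      refine hac.ne_of_not_backtracking (fun k => W.getVert (i + k)) d
        (fun k hk => hadj (i + k) (by omega) (by omega)) (fun k hk => ?_) h
      exact (hW (i + k) (by omega)).1.2.2
    intro x y hxy
    simp only [Prod.mk.injEq] at hxy
    rcases lt_trichotomy x y with h | h | h
    · exact (key x y h y.2 hxy.1 hxy.2).elim
    · exact h
    · exact (key y x h x.2 hxy.1.symm hxy.2.symm).elim
  have := Fintype.card_le_of_injective _ hinj
  rw [Fintype.card_fin] at this
  exact Nat.lt_succ_of_le this

include hP in
theorem isProtocolWalk_path (i : I) : IsProtocolWalk (switchProtocol P T A) (P i) := by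
  intro n hn
  refine ⟨⟨(P i).adj_getVert_succ (by omega), (P i).adj_getVert_succ (by omega), fun h => ?_⟩,
    Or.inl ⟨i, n, hn, rfl⟩⟩
  have := (hP i).getVert_injOn (x₁ := n) (x₂ := n + 2) (by simp; omega) (by simpa using hn) h
  omega

-- The walk follows path `i` to position `n`, crosses a forest component, and follows path `j` from
-- position `m`. If the crossing is trivial, `hij` excludes turning straight back along an edge.
include hP hdis hT in
theorem delivers_switch (hTG : T ≤ G) {S : Finset (Sym2 V)} {i j : I} {n m : ℕ} (hA : A i n)
    (hn : n ≤ (P i).length) (hm : m ≤ (P j).length) (hij : i = j → n < m)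
    (hreach : T.Reachable ((P i).getVert n) ((P j).getVert m))
    (hSi : ∀ k < n, s((P i).getVert k, (P i).getVert (k + 1)) ∈ S)
    (hSj : ∀ k, m ≤ k → k < (P j).length → s((P j).getVert k, (P j).getVert (k + 1)) ∈ S)
    (hST : ∀ e ∈ T.edgeSet, e ∈ S) : Delivers G s r (switchProtocol P T A) S := by
  classical
  obtain ⟨q, hq⟩ := hreach.exists_isPath
  have hqv : ∀ k, (q.mapLe hTG).getVert k = q.getVert k := fun k => by
    simp [SimpleGraph.Walk.mapLe, SimpleGraph.Walk.getVert_map]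
  have hql : (q.mapLe hTG).length = q.length := by simp [SimpleGraph.Walk.mapLe]
  have hnotT : ∀ i k, k < (P i).length → ¬ T.Adj ((P i).getVert k) ((P i).getVert (k + 1)) :=
    fun i k hk h => hT i _ (mem_edges_iff_exists_getVert.2 ⟨k, hk, rfl⟩) h
  have hadjq : ∀ k < q.length, T.Adj (q.getVert k) (q.getVert (k + 1)) :=
    fun k hk => q.adj_getVert_succ hk
  have hwalkq : IsProtocolWalk (switchProtocol P T A) (q.mapLe hTG) := by
    intro k hk
    rw [hql] at hk
    rw [hqv, hqv, hqv]
    have e1 := hadjq k (by omega)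
    have e2 := hadjq (k + 1) (by omega)
    refine ⟨⟨hTG e1, hTG e2, fun h => ?_⟩, Or.inr ⟨Or.inl e1, Or.inl e2⟩⟩
    have := hq.getVert_injOn (x₁ := k) (x₂ := k + 2) (by simp; omega) (by simpa using hk) h
    omega
  have hwalkj : IsProtocolWalk (switchProtocol P T A) ((P j).drop m) := by
    intro k hk
    rw [SimpleGraph.Walk.drop_length] at hk
    rw [SimpleGraph.Walk.drop_getVert, SimpleGraph.Walk.drop_getVert,
      SimpleGraph.Walk.drop_getVert]
    exact isProtocolWalk_path hP j (m + k) (by omega)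
  have hwalki : IsProtocolWalk (switchProtocol P T A) ((P i).take n) := by
    intro k hk
    rw [SimpleGraph.Walk.take_length, min_eq_left hn] at hk
    rw [SimpleGraph.Walk.take_getVert, SimpleGraph.Walk.take_getVert,
      SimpleGraph.Walk.take_getVert, min_eq_right (by omega), min_eq_right (by omega),
      min_eq_right (by omega)]
    exact isProtocolWalk_path hP i k (by omega)
  have hwalk2 : IsProtocolWalk (switchProtocol P T A) ((q.mapLe hTG).append ((P j).drop m)) := by
    refine isProtocolWalk_append hwalkq hwalkj fun h1 h2 => ?_
    rw [hql] at h1 ⊢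
    rw [SimpleGraph.Walk.drop_length] at h2
    rw [hqv, SimpleGraph.Walk.drop_getVert]
    have e1 := hadjq (q.length - 1) (by omega)
    rw [Nat.sub_add_cancel h1, q.getVert_length] at e1
    refine ⟨⟨hTG e1, (P j).adj_getVert_succ (by omega), fun h => ?_⟩,
      Or.inr ⟨Or.inl e1, Or.inr ⟨j, m, by omega, rfl, rfl⟩⟩⟩
    dsimp only at h
    rw [h] at e1
    exact hnotT j m (by omega) e1.symm
  have hwalk : IsProtocolWalk (switchProtocol P T A)
      (((P i).take n).append ((q.mapLe hTG).append ((P j).drop m))) := by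
    refine isProtocolWalk_append hwalki hwalk2 fun h1 h2 => ?_
    rw [SimpleGraph.Walk.take_length, min_eq_left hn] at h1 ⊢
    rw [SimpleGraph.Walk.take_getVert, min_eq_right (by omega)]
    obtain ⟨n, rfl⟩ : ∃ k, n = k + 1 := ⟨n - 1, by omega⟩
    rw [Nat.add_sub_cancel]
    have ei := (P i).adj_getVert_succ (i := n) (by omega)
    have hin : ∃ i' n', n' < (P i').length ∧ A i' (n' + 1) ∧
        (P i).getVert n = (P i').getVert n' ∧ (P i).getVert (n + 1) = (P i').getVert (n' + 1) :=
      ⟨i, n, by omega, hA, rfl, rfl⟩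
    by_cases hlt : 0 < q.length
    · have hv : ((q.mapLe hTG).append ((P j).drop m)).getVert 1 = q.getVert 1 := by
        rw [SimpleGraph.Walk.getVert_append, hql]
        split_ifs with h
        · exact hqv 1
        · have hlen : q.length = 1 := by omega
          have hend := q.getVert_length
          rw [hlen] at hend
          rw [hlen, Nat.sub_self, SimpleGraph.Walk.getVert_zero, hend]
      rw [hv]
      have e1 := hadjq 0 (by omega)
      rw [q.getVert_zero] at e1
      refine ⟨⟨ei, hTG e1, fun h => ?_⟩, Or.inr ⟨Or.inr hin, Or.inl e1⟩⟩
      dsimp only at h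
      rw [← h] at e1
      exact hnotT i n (by omega) e1.symm
    · rw [SimpleGraph.Walk.length_append, SimpleGraph.Walk.drop_length, hql] at h2
      have hlen : q.length = 0 := by omega
      have hv : (P i).getVert (n + 1) = (P j).getVert m :=
        SimpleGraph.Walk.eq_of_length_eq_zero hlen
      have hml : m < (P j).length := by omega
      have ej := (P j).adj_getVert_succ hml
      rw [SimpleGraph.Walk.getVert_append, hql, if_neg (by omega), SimpleGraph.Walk.drop_getVert,
        hlen, Nat.sub_zero]
      refine ⟨⟨ei, ?_, fun h => ?_⟩, Or.inr ⟨Or.inr hin, Or.inr ⟨j, m, hml, hv, rfl⟩⟩⟩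
      · dsimp only
        rwa [hv]
      · dsimp only at h
        obtain ⟨h3, h4⟩ := edge_injective hP hdis (show n < (P i).length by omega) hml
          (by rw [h, hv, Sym2.eq_swap])
        have := hij h3
        omega
  refine ⟨_, hwalk, fun e he => ?_⟩
  rw [SimpleGraph.Walk.edges_append, SimpleGraph.Walk.edges_append, List.mem_append,
    List.mem_append] at he
  rcases he with he | he | he
  · obtain ⟨k, hk, rfl⟩ := mem_edges_iff_exists_getVert.1 he
    rw [SimpleGraph.Walk.take_length, min_eq_left hn] at hk
    rw [SimpleGraph.Walk.take_getVert, SimpleGraph.Walk.take_getVert, min_eq_right (by omega),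
      min_eq_right (by omega)]
    exact hSi k hk
  · obtain ⟨k, hk, rfl⟩ := mem_edges_iff_exists_getVert.1 he
    rw [hqv, hqv]
    exact hST _ (hadjq k (by omega))
  · obtain ⟨k, hk, rfl⟩ := mem_edges_iff_exists_getVert.1 he
    rw [SimpleGraph.Walk.drop_length] at hk
    rw [SimpleGraph.Walk.drop_getVert, SimpleGraph.Walk.drop_getVert]
    exact hSj (m + k) (by omega) (by omega)

end Protocol

/-! ### Withstanding small failures that are not cuts -/

theorem exists_isEdgeCut_card_eq {V : Type*} [Fintype V] (G : SimpleGraph V) {s r : V}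
    (hsr : s ≠ r) : ∃ F, IsEdgeCut G s r F ∧ F.card = edgeConnectivity G s r := by
  classical
  refine Nat.sInf_mem (s := {k : ℕ | ∃ F : Finset (Sym2 V), IsEdgeCut G s r F ∧ F.card = k})
    ⟨_, G.edgeFinset, ⟨by simp, ?_⟩, rfl⟩
  refine not_reachable_of_closed (P := fun v => v = s) rfl hsr.symm fun u v h => ?_
  simp at h

/-- Some finite protocol withstands the failure of any set of edges that is not larger than the
edge connectivity, unless this set is an edge cut. -/
theorem exists_finite_protocol_delivers {V : Type*} [Fintype V] (G : SimpleGraph V) {s r : V}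
    (hsr : s ≠ r) : ∃ A, IsFiniteProtocol G s r A ∧ ∀ F : Finset (Sym2 V),
      (F : Set (Sym2 V)) ⊆ G.edgeSet → F.card ≤ edgeConnectivity G s r → ¬ IsEdgeCut G s r F →
      ∀ S : Finset (Sym2 V), (∀ e ∈ G.edgeSet, e ∉ F → e ∈ S) → Delivers G s r A S := by
  classical
  rcases Nat.eq_zero_or_pos (edgeConnectivity G s r) with h0 | hpos
  -- Here only `F = ∅` is small enough, and it is a cut.
  · refine ⟨∅, isFiniteProtocol_empty G s r, fun F _ hF hcut => (hcut ?_).elim⟩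
    obtain ⟨F', hF', hcard⟩ := exists_isEdgeCut_card_eq G hsr
    rw [h0, Finset.card_eq_zero] at hcard
    rw [h0, Nat.le_zero, Finset.card_eq_zero] at hF
    rwa [hF, ← hcard]
  obtain ⟨P, hP, hdis⟩ := exists_edge_disjoint_paths G s r
  have : Nonempty (Fin (edgeConnectivity G s r)) := ⟨⟨0, hpos⟩⟩
  obtain ⟨T, hTle, hac, hreach⟩ := SimpleGraph.exists_isAcyclic_reachable_eq_le
    (G := G.deleteEdges {e | ∃ i, e ∈ (P i).edges})
  have hTG : T ≤ G := hTle.trans (SimpleGraph.deleteEdges_le _)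
  have hT : ∀ i, ∀ e ∈ (P i).edges, e ∉ T.edgeSet := by
    intro i e he heT
    have := SimpleGraph.edgeSet_mono hTle heT
    rw [SimpleGraph.edgeSet_deleteEdges] at this
    exact this.2 ⟨i, he⟩
  -- The trails run through forest components; `L` counts the vertices of a path, one more than its
  -- edges.
  obtain ⟨A, ρ, h1, h2, h3, h4⟩ := exists_switching_rank (fun i => (P i).length + 1)
    (fun i n => T.connectedComponentMk ((P i).getVert n)) (fun i => Nat.succ_pos _)
    (fun i j => by simp)
  refine ⟨switchProtocol P T A, switchProtocol_finite hP hdis hT h1 h2 hac, ?_⟩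
  intro F hFG hFcard hcut S hS
  by_contra hdel
  have hPG : ∀ i n, n < (P i).length → s((P i).getVert n, (P i).getVert (n + 1)) ∈ G.edgeSet :=
    fun i n hn => (P i).adj_getVert_succ hn
  have hhit : ∀ i, ∃ n < (P i).length, s((P i).getVert n, (P i).getVert (n + 1)) ∈ F := by
    intro i
    by_contra hcon
    push Not at hcon
    refine hdel ⟨P i, isProtocolWalk_path hP i, fun e he => ?_⟩
    obtain ⟨n, hn, rfl⟩ := mem_edges_iff_exists_getVert.1 he
    exact hS _ (hPG i n hn) (hcon n hn)
  choose c hc hcF using hhit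
  -- Disjoint paths need different edges of `F`, and `F` has no more edges than there are paths:
  -- each path loses one edge, and nothing else fails.
  have hsurj : ∀ e ∈ F, ∃ i, s((P i).getVert (c i), (P i).getVert (c i + 1)) = e := by
    have himg : Finset.univ.image (fun i => s((P i).getVert (c i), (P i).getVert (c i + 1))) = F := by
      refine Finset.eq_of_subset_of_card_le ?_ ?_
      · intro e he
        obtain ⟨i, -, rfl⟩ := Finset.mem_image.1 he
        exact hcF i
      · rw [Finset.card_image_of_injective _ fun i j hij =>
          (edge_injective hP hdis (hc i) (hc j) hij).1, Finset.card_univ, Fintype.card_fin]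
        exact hFcard
    intro e he
    rw [← himg] at he
    obtain ⟨i, -, h⟩ := Finset.mem_image.1 he
    exact ⟨i, h⟩
  have hPS : ∀ i n, n < (P i).length → n ≠ c i →
      s((P i).getVert n, (P i).getVert (n + 1)) ∈ S := by
    intro i n hn hne
    refine hS _ (hPG i n hn) fun he => hne ?_
    obtain ⟨j, hj⟩ := hsurj _ he
    obtain ⟨rfl, h⟩ := edge_injective hP hdis (hc j) hn hj
    exact h.symm
  -- The failed edge joins positions `c i` and `c i + 1`, so trail `i` is cut just before `c i + 1`.
  have hsep := h4 (fun i => c i + 1) fun i n hA hn j m hm hmL heq => by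
    refine hdel (delivers_switch hP hdis hT hTG hA (Nat.lt_succ_iff.1 (h3 i n hA))
      (Nat.lt_succ_iff.1 hmL) ?_ (SimpleGraph.ConnectedComponent.exact heq.symm) ?_ ?_ ?_)
    · rintro rfl
      omega
    · intro k hk
      exact hPS i k (by have := h3 i n hA; omega) (by omega)
    · intro k hk hkl
      exact hPS j k hkl (by omega)
    · intro e he
      refine hS e (SimpleGraph.edgeSet_mono hTG he) fun heF => ?_
      obtain ⟨i, rfl⟩ := hsurj e heF
      exact hT i _ (mem_edges_iff_exists_getVert.2 ⟨c i, hc i, rfl⟩) he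
  -- The side of `s` consists of the vertices whose forest component meets some path before its
  -- failed edge.
  refine hcut ⟨hFG, not_reachable_of_closed (P := fun u => ∃ i n, n < (P i).length + 1 ∧
    n < c i + 1 ∧ T.connectedComponentMk u = T.connectedComponentMk ((P i).getVert n)) ?_ ?_ ?_⟩
  · exact ⟨⟨0, hpos⟩, 0, by omega, by omega, by simp⟩
  · rintro ⟨i, n, hn, hni, heq⟩
    refine hsep i n i (P i).length hn hni (hc i) (Nat.lt_succ_self _) ?_
    rw [← heq, SimpleGraph.Walk.getVert_length]
  · rintro u w huw ⟨i, n, hn, hni, heq⟩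
    rw [SimpleGraph.deleteEdges_adj] at huw
    by_cases htr : ∃ j, s(u, w) ∈ (P j).edges
    · obtain ⟨j, hj⟩ := htr
      obtain ⟨m, hm, he⟩ := mem_edges_iff_exists_getVert.1 hj
      have hmc : m ≠ c j := by
        rintro rfl
        exact huw.2 (he ▸ hcF j)
      have hmlt : m < c j + 1 := by
        by_contra hge
        rcases Sym2.eq_iff.1 he with ⟨rfl, -⟩ | ⟨rfl, -⟩
        · exact hsep i n j m hn hni (by omega) (by omega) heq.symm
        · exact hsep i n j (m + 1) hn hni (by omega) (by omega) heq.symm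
      rcases Sym2.eq_iff.1 he with ⟨-, rfl⟩ | ⟨-, rfl⟩
      · exact ⟨j, m + 1, by omega, by omega, rfl⟩
      · exact ⟨j, m, by omega, by omega, rfl⟩
    · refine ⟨i, n, hn, hni, ?_⟩
      rw [← heq]
      refine SimpleGraph.ConnectedComponent.eq.2 ?_
      rw [hreach]
      refine SimpleGraph.Adj.reachable ?_
      rw [SimpleGraph.deleteEdges_adj]
      exact ⟨huw.1.symm, fun ⟨j, hj⟩ => htr ⟨j, by rwa [Sym2.eq_swap] at hj⟩⟩

/-! ### Reliability polynomials -/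

section Bernstein

/-- The sign of a polynomial in Bernstein form with small integral coefficients is, close to zero,
the sign of its first nonzero coefficient. -/
theorem bernstein_sum_lower_bound {m j : ℕ} (hj : j ≤ m) {d : ℕ → ℤ}
    (hd : ∀ k, |d k| ≤ m.choose k) (hlt : ∀ k < j, d k = 0) (hpos : 0 < d j) {q : ℝ} (hq : 0 ≤ q)
    (hq' : q < ((3 : ℝ) ^ m)⁻¹) :
    0 ≤ ∑ k ∈ Finset.range (m + 1), (d k : ℝ) * (q ^ k * (1 - q) ^ (m - k)) ∧
      (0 < q → 0 < ∑ k ∈ Finset.range (m + 1), (d k : ℝ) * (q ^ k * (1 - q) ^ (m - k))) := by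
  have h3 : q * 3 ^ m < 1 := by
    rwa [← one_div, lt_div_iff₀ (by positivity)] at hq'
  -- The final estimate needs `(m + 2 ^ m - 1) * q < 1`; this is where `3 ^ m` enters.
  have hm3 : ∀ m : ℕ, m + 2 ^ m ≤ 3 ^ m + 1 := by
    intro m
    induction m with
    | zero => norm_num
    | succ m ih =>
      have := Nat.pow_le_pow_left (show 2 ≤ 3 by norm_num) m
      have := Nat.one_le_two_pow (n := m)
      rw [pow_succ, pow_succ]
      omega
  have hm3' : (m : ℝ) + 2 ^ m ≤ 3 ^ m + 1 := by exact_mod_cast hm3 m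
  have h31 : (1 : ℝ) ≤ 3 ^ m := one_le_pow₀ (by norm_num)
  have hq1 : q ≤ 1 := by nlinarith
  -- The binomial coefficients sum to `2 ^ m` with index `j` included. Returning one `q ^ (j + 1)`
  -- at `k = j`, possible as the coefficient there is at least `1`, lowers the constant from `m + 2
  -- ^ m` to `m + 2 ^ m - 1`.
  have hterm : ∀ k ∈ Finset.range (m + 1),
      -((m.choose k : ℝ) * q ^ (j + 1)) + (if k = j then q ^ j * (1 - m * q) + q ^ (j + 1) else 0) ≤
        (d k : ℝ) * (q ^ k * (1 - q) ^ (m - k)) := by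
    intro k hk
    have hk' : k ≤ m := Nat.lt_succ_iff.1 (Finset.mem_range.1 hk)
    have hch : (1 : ℝ) ≤ m.choose k := by exact_mod_cast Nat.choose_pos hk'
    rcases lt_trichotomy k j with h | rfl | h
    · rw [if_neg h.ne, hlt k h, Int.cast_zero, zero_mul, add_zero]
      have : 0 ≤ (m.choose k : ℝ) * q ^ (j + 1) := by positivity
      linarith
    · rw [if_pos rfl]
      have h1 : (1 : ℝ) ≤ d k := by exact_mod_cast hpos
      have h2 : 1 - m * q ≤ (1 - q) ^ (m - k) := by
        have h4 := one_add_mul_le_pow (a := -q) (by linarith) (m - k)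
        have h5 : ((m - k : ℕ) : ℝ) ≤ m := by exact_mod_cast Nat.sub_le m k
        rw [← sub_eq_add_neg] at h4
        nlinarith
      have h6 : q ^ k * (1 - m * q) ≤ q ^ k * (1 - q) ^ (m - k) :=
        mul_le_mul_of_nonneg_left h2 (by positivity)
      have h7 : 0 ≤ q ^ k * (1 - q) ^ (m - k) :=
        mul_nonneg (by positivity) (pow_nonneg (by linarith) _)
      have h8 : q ^ (k + 1) ≤ (m.choose k : ℝ) * q ^ (k + 1) :=
        le_mul_of_one_le_left (by positivity) hch
      have h9 := le_mul_of_one_le_left h7 h1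
      linarith
    · rw [if_neg h.ne', add_zero]
      have h1 : -(m.choose k : ℝ) ≤ d k := by exact_mod_cast (abs_le.1 (hd k)).1
      have h2 : q ^ k * (1 - q) ^ (m - k) ≤ q ^ (j + 1) := by
        refine (mul_le_of_le_one_right (by positivity) (pow_le_one₀ (by linarith)
          (by linarith))).trans ?_
        exact pow_le_pow_of_le_one hq hq1 h
      have h7 : 0 ≤ q ^ k * (1 - q) ^ (m - k) :=
        mul_nonneg (by positivity) (pow_nonneg (by linarith) _)
      have h3 := mul_le_mul_of_nonneg_right h1 h7
      have h4 := mul_le_mul_of_nonneg_left h2 (show (0 : ℝ) ≤ m.choose k by positivity)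
      linarith
  have hsum := Finset.sum_le_sum hterm
  have h2m : ∑ k ∈ Finset.range (m + 1), (m.choose k : ℝ) = 2 ^ m := by
    exact_mod_cast Nat.sum_range_choose m
  rw [Finset.sum_add_distrib, Finset.sum_neg_distrib, ← Finset.sum_mul, h2m,
    Finset.sum_ite_eq' (Finset.range (m + 1)) j, if_pos (Finset.mem_range.2 (by omega))] at hsum
  have hfac : 0 < 1 - (m + 2 ^ m - 1) * q := by nlinarith
  have heq : -(2 ^ m * q ^ (j + 1)) + (q ^ j * (1 - m * q) + q ^ (j + 1)) =
      q ^ j * (1 - (m + 2 ^ m - 1) * q) := by ring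
  rw [heq] at hsum
  exact ⟨le_trans (by positivity) hsum, fun hq0 => lt_of_lt_of_le (by positivity) hsum⟩

end Bernstein

/-! ### Comparing protocols through their Bernstein coefficients -/

section Reliability

variable {V : Type*} {G : SimpleGraph V} {s r : V}

open Classical in
/-- The number of sets of `k` edges the failure of which the protocol `A` withstands. -/
noncomputable def numWithstood (G : SimpleGraph V) (s r : V) (A : Set (V × V × V))
    (E : Finset (Sym2 V)) (k : ℕ) : ℕ :=
  ((E.powersetCard k).filter fun F => Delivers G s r A (E \ F)).card

theorem numWithstood_le (A : Set (V × V × V)) (E : Finset (Sym2 V)) (k : ℕ) :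
    numWithstood G s r A E k ≤ E.card.choose k := by
  classical
  rw [← Finset.card_powersetCard]
  exact Finset.card_filter_le _ _

theorem ncard_edgeSet_eq {E : Finset (Sym2 V)} (hE : (E : Set (Sym2 V)) = G.edgeSet) :
    G.edgeSet.ncard = E.card := by
  rw [← hE, Set.ncard_coe_finset]

theorem IsEdgeCut.not_delivers {F E : Finset (Sym2 V)} [DecidableEq V] (hF : IsEdgeCut G s r F)
    (A : Set (V × V × V)) : ¬ Delivers G s r A (E \ F) := by
  rintro ⟨W, -, hW⟩
  refine hF.2 ⟨W.toDeleteEdges _ fun e he heF => ?_⟩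
  exact (Finset.mem_sdiff.1 (hW e he)).2 heF

open Classical in
theorem numMinEdgeCuts_eq {E : Finset (Sym2 V)} (hE : (E : Set (Sym2 V)) = G.edgeSet) :
    numMinEdgeCuts G s r =
      (E.powerset.filter fun F => IsEdgeCut G s r F ∧ F.card = edgeConnectivity G s r).card := by
  rw [numMinEdgeCuts, ← Set.ncard_coe_finset]
  congr 1
  ext F
  simp only [Set.mem_ofPred_eq, Finset.coe_filter, Finset.mem_powerset]
  refine ⟨fun h => ⟨?_, h⟩, fun h => h.2⟩
  rw [← Finset.coe_subset, hE]
  exact h.1.1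

open Classical in
theorem sum_minEdgeCuts {E : Finset (Sym2 V)} (hE : (E : Set (Sym2 V)) = G.edgeSet) (q : ℝ) :
    ∑ F ∈ E.powerset with IsEdgeCut G s r F ∧ F.card = edgeConnectivity G s r,
        q ^ F.card * (1 - q) ^ (E.card - F.card) =
      numMinEdgeCuts G s r *
        (q ^ edgeConnectivity G s r * (1 - q) ^ (E.card - edgeConnectivity G s r)) := by
  rw [numMinEdgeCuts_eq hE, ← nsmul_eq_mul]
  refine Finset.sum_eq_card_nsmul fun F hF => ?_
  rw [(Finset.mem_filter.1 hF).2.2]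

variable [Fintype V]

open Classical in
theorem reliability_eq_sum (A : Set (V × V × V)) {E : Finset (Sym2 V)}
    (hE : (E : Set (Sym2 V)) = G.edgeSet) (q : ℝ) :
    reliability G s r A (fun _ => 1 - q) =
      ∑ F ∈ E.powerset with Delivers G s r A (E \ F), q ^ F.card * (1 - q) ^ (E.card - F.card) := by
  have hE' : G.edgeFinset = E := by
    rw [← Finset.coe_inj, hE, SimpleGraph.coe_edgeFinset]
  unfold reliability
  rw [hE']
  refine Finset.sum_nbij' (fun S => E \ S) (fun F => E \ F) ?_ ?_ ?_ ?_ ?_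
  · intro S hS
    simp only [Finset.mem_filter, Finset.mem_powerset] at hS ⊢
    rw [Finset.sdiff_sdiff_eq_self hS.1]
    exact ⟨Finset.sdiff_subset, hS.2⟩
  · intro F hF
    simp only [Finset.mem_filter, Finset.mem_powerset] at hF ⊢
    exact ⟨Finset.sdiff_subset, hF.2⟩
  · intro S hS
    simp only [Finset.mem_filter, Finset.mem_powerset] at hS
    exact Finset.sdiff_sdiff_eq_self hS.1
  · intro F hF
    simp only [Finset.mem_filter, Finset.mem_powerset] at hF
    exact Finset.sdiff_sdiff_eq_self hF.1
  · intro S hS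
    simp only [Finset.mem_filter, Finset.mem_powerset] at hS
    have := Finset.card_sdiff_add_card_eq_card hS.1
    rw [Finset.prod_const, Finset.prod_const, sub_sub_cancel, mul_comm,
      show E.card - (E \ S).card = S.card by omega]

theorem reliability_eq_sum_numWithstood (A : Set (V × V × V)) {E : Finset (Sym2 V)}
    (hE : (E : Set (Sym2 V)) = G.edgeSet) (q : ℝ) :
    reliability G s r A (fun _ => 1 - q) = ∑ k ∈ Finset.range (E.card + 1),
      (numWithstood G s r A E k : ℝ) * (q ^ k * (1 - q) ^ (E.card - k)) := by
  classical
  rw [reliability_eq_sum A hE, Finset.sum_filter, Finset.sum_powerset]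
  refine Finset.sum_congr rfl fun k _ => ?_
  rw [← Finset.sum_filter, numWithstood, ← nsmul_eq_mul]
  refine (Finset.sum_eq_card_nsmul fun F hF => ?_).trans (by congr!)
  rw [(Finset.mem_powersetCard.1 (Finset.mem_filter.1 hF).1).2]

theorem exists_coe_eq_edgeSet (G : SimpleGraph V) :
    ∃ E : Finset (Sym2 V), (E : Set (Sym2 V)) = G.edgeSet := by
  classical
  exact ⟨G.edgeFinset, G.coe_edgeFinset⟩

/-- The order of two reliabilities does not change for `0 < q < 3 ^ (-m)`. -/
theorem reliability_le_of_le (A B : Set (V × V × V)) {q₀ : ℝ} (h₀ : 0 < q₀)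
    (h₀' : q₀ < ((3 : ℝ) ^ G.edgeSet.ncard)⁻¹)
    (hle : reliability G s r B (fun _ => 1 - q₀) ≤ reliability G s r A (fun _ => 1 - q₀))
    {q : ℝ} (hq : 0 ≤ q) (hq' : q < ((3 : ℝ) ^ G.edgeSet.ncard)⁻¹) :
    reliability G s r B (fun _ => 1 - q) ≤ reliability G s r A (fun _ => 1 - q) := by
  classical
  obtain ⟨E, hE⟩ := exists_coe_eq_edgeSet G
  rw [ncard_edgeSet_eq hE] at h₀' hq'
  have hdiff : ∀ (X Y : Set (V × V × V)) (q : ℝ),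
      reliability G s r X (fun _ => 1 - q) - reliability G s r Y (fun _ => 1 - q) =
      ∑ k ∈ Finset.range (E.card + 1),
        (((numWithstood G s r X E k : ℤ) - numWithstood G s r Y E k : ℤ) : ℝ) *
          (q ^ k * (1 - q) ^ (E.card - k)) := by
    intro X Y q
    rw [reliability_eq_sum_numWithstood X hE, reliability_eq_sum_numWithstood Y hE,
      ← Finset.sum_sub_distrib]
    refine Finset.sum_congr rfl fun k _ => ?_
    push_cast
    ring
  have habs : ∀ (X Y : Set (V × V × V)) (k : ℕ),
      |(numWithstood G s r X E k : ℤ) - numWithstood G s r Y E k| ≤ E.card.choose k := by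
    intro X Y k
    have h1 := numWithstood_le (G := G) (s := s) (r := r) X E k
    have h2 := numWithstood_le (G := G) (s := s) (r := r) Y E k
    rw [abs_le]
    omega
  by_cases heq : ∀ k ≤ E.card, numWithstood G s r A E k = numWithstood G s r B E k
  · rw [← sub_nonneg, hdiff]
    refine (Finset.sum_eq_zero fun k hk => ?_).ge
    rw [heq k (Nat.lt_succ_iff.1 (Finset.mem_range.1 hk)), sub_self, Int.cast_zero, zero_mul]
  have hex : ∃ k, k ≤ E.card ∧ numWithstood G s r A E k ≠ numWithstood G s r B E k := by
    push Not at heq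
    exact heq
  obtain ⟨hj, hne⟩ := Nat.find_spec hex
  have hmin : ∀ k < Nat.find hex, numWithstood G s r A E k = numWithstood G s r B E k := by
    intro k hk
    by_contra hk'
    exact Nat.find_min hex hk ⟨by omega, hk'⟩
  -- The first differing coefficient decides: if it favoured `B`, then `B` would be strictly better
  -- at `q₀`.
  rcases lt_or_gt_of_ne hne with h | h
  · have := (bernstein_sum_lower_bound hj (habs B A) (fun k hk => by rw [hmin k hk, sub_self])
      (by omega) h₀.le h₀').2 h₀
    rw [← hdiff] at this
    linarith
  · have := (bernstein_sum_lower_bound hj (habs A B) (fun k hk => by rw [hmin k hk, sub_self])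
      (by omega) hq hq').1
    rw [← hdiff] at this
    linarith

theorem one_sub_reliability (A : Set (V × V × V)) {E : Finset (Sym2 V)}
    (hE : (E : Set (Sym2 V)) = G.edgeSet) (q : ℝ) [DecidableEq V]
    [DecidablePred fun F => ¬ Delivers G s r A (E \ F)] :
    1 - reliability G s r A (fun _ => 1 - q) =
      ∑ F ∈ E.powerset with ¬ Delivers G s r A (E \ F),
        q ^ F.card * (1 - q) ^ (E.card - F.card) := by
  classical
  have h1 : ∑ F ∈ E.powerset, q ^ F.card * (1 - q) ^ (E.card - F.card) = 1 := by
    rw [Finset.sum_pow_mul_eq_add_pow, add_sub_cancel, one_pow]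
  rw [← Finset.sum_filter_add_sum_filter_not E.powerset
    (fun F => Delivers G s r A (E \ F))] at h1
  rw [reliability_eq_sum A hE, sub_eq_iff_eq_add']
  exact h1.symm.trans (by congr!)

/-- Every protocol fails with each minimum cut; Bernoulli's inequality for `(1 - q) ^ (m - e)` gives
the error term. -/
theorem reliability_le_of_minEdgeCuts (A : Set (V × V × V)) {q : ℝ} (hq : 0 ≤ q) (hq1 : q ≤ 1) :
    reliability G s r A (fun _ => 1 - q) ≤
      1 - numMinEdgeCuts G s r * q ^ edgeConnectivity G s r +
        numMinEdgeCuts G s r * G.edgeSet.ncard * q ^ (edgeConnectivity G s r + 1) := by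
  classical
  obtain ⟨E, hE⟩ := exists_coe_eq_edgeSet G
  have h1 := one_sub_reliability (s := s) (r := r) A hE q
  have h2 : ∑ F ∈ E.powerset with IsEdgeCut G s r F ∧ F.card = edgeConnectivity G s r,
      q ^ F.card * (1 - q) ^ (E.card - F.card) ≤
      ∑ F ∈ E.powerset with ¬ Delivers G s r A (E \ F),
        q ^ F.card * (1 - q) ^ (E.card - F.card) := by
    refine Finset.sum_le_sum_of_subset_of_nonneg (fun F hF => ?_) fun F _ _ =>
      mul_nonneg (pow_nonneg hq _) (pow_nonneg (by linarith) _)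
    simp only [Finset.mem_filter] at hF ⊢
    exact ⟨hF.1, hF.2.1.not_delivers A⟩
  rw [sum_minEdgeCuts hE, ← h1] at h2
  set e := edgeConnectivity G s r
  set c : ℝ := (numMinEdgeCuts G s r : ℝ)
  have hc : 0 ≤ c := Nat.cast_nonneg _
  have h3 : 1 - E.card * q ≤ (1 - q) ^ (E.card - e) := by
    have h4 := one_add_mul_le_pow (a := -q) (by linarith) (E.card - e)
    have h5 : ((E.card - e : ℕ) : ℝ) ≤ E.card := by exact_mod_cast Nat.sub_le _ _
    rw [← sub_eq_add_neg] at h4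
    nlinarith
  have h6 := mul_le_mul_of_nonneg_left h3 (show 0 ≤ c * q ^ e by positivity)
  rw [ncard_edgeSet_eq hE]
  have h7 : c * q ^ e * (1 - E.card * q) = c * q ^ e - c * E.card * q ^ (e + 1) := by ring
  linarith

/-- The reliability of a protocol which withstands the failure of any set of edges that is not
larger than the edge connectivity, unless this set is an edge cut. -/
theorem le_reliability_of_delivers {A : Set (V × V × V)}
    (hA : ∀ F : Finset (Sym2 V), (F : Set (Sym2 V)) ⊆ G.edgeSet →
      F.card ≤ edgeConnectivity G s r → ¬ IsEdgeCut G s r F →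
      ∀ S : Finset (Sym2 V), (∀ e ∈ G.edgeSet, e ∉ F → e ∈ S) → Delivers G s r A S)
    {q : ℝ} (hq : 0 ≤ q) (hq1 : q ≤ 1) :
    1 - numMinEdgeCuts G s r * q ^ edgeConnectivity G s r -
      2 ^ G.edgeSet.ncard * q ^ (edgeConnectivity G s r + 1) ≤
        reliability G s r A (fun _ => 1 - q) := by
  classical
  obtain ⟨E, hE⟩ := exists_coe_eq_edgeSet G
  have h1 := one_sub_reliability (s := s) (r := r) A hE q
  have h0 : ∀ F : Finset (Sym2 V), 0 ≤ q ^ F.card * (1 - q) ^ (E.card - F.card) := fun F =>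
    mul_nonneg (pow_nonneg hq _) (pow_nonneg (by linarith) _)
  have hone : ∀ k : ℕ, (1 - q) ^ k ≤ 1 := fun k => pow_le_one₀ (by linarith) (by linarith)
  set e := edgeConnectivity G s r with he
  -- A set that stops `A` without being a minimum cut has more than `e` edges and so weight at most
  -- `q ^ (e + 1)`; there are at most `2 ^ m` such sets.
  have h2 : ∑ F ∈ E.powerset with ¬ Delivers G s r A (E \ F),
        q ^ F.card * (1 - q) ^ (E.card - F.card) ≤
      ∑ F ∈ E.powerset with IsEdgeCut G s r F ∧ F.card = e,
        q ^ F.card * (1 - q) ^ (E.card - F.card) + ∑ F ∈ E.powerset, q ^ (e + 1) := by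
    rw [Finset.sum_filter, Finset.sum_filter, ← Finset.sum_add_distrib]
    refine Finset.sum_le_sum fun F hF => ?_
    have hqe : 0 ≤ q ^ (e + 1) := pow_nonneg hq _
    have hFG : (F : Set (Sym2 V)) ⊆ G.edgeSet := by
      rw [← hE]
      exact Finset.coe_subset.2 (Finset.mem_powerset.1 hF)
    by_cases hdel : Delivers G s r A (E \ F)
    · rw [if_neg (not_not.2 hdel)]
      refine add_nonneg ?_ hqe
      split_ifs
      · exact h0 F
      · exact le_rfl
    rw [if_pos hdel]
    by_cases hcard : F.card ≤ e
    · have hcut : IsEdgeCut G s r F := by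
        by_contra hcut
        refine hdel (hA F hFG hcard hcut _ fun x hx hxF => Finset.mem_sdiff.2 ⟨?_, hxF⟩)
        rw [← hE] at hx
        exact hx
      rw [if_pos ⟨hcut, le_antisymm hcard (edgeConnectivity_le_card hcut)⟩]
      linarith
    · rw [if_neg fun h => hcard h.2.le, zero_add]
      refine (mul_le_of_le_one_right (pow_nonneg hq _) (hone _)).trans ?_
      exact pow_le_pow_of_le_one hq hq1 (by omega)
  rw [← h1, sum_minEdgeCuts hE, Finset.sum_const, Finset.card_powerset, nsmul_eq_mul, ← he] at h2
  push_cast at h2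
  rw [ncard_edgeSet_eq hE]
  have h3 : (numMinEdgeCuts G s r : ℝ) * (q ^ e * (1 - q) ^ (E.card - e)) ≤
      numMinEdgeCuts G s r * q ^ e :=
    mul_le_mul_of_nonneg_left (mul_le_of_le_one_right (pow_nonneg hq _) (hone _))
      (Nat.cast_nonneg _)
  linarith

theorem reliability_le_optimalReliability {A : Set (V × V × V)} (hA : IsFiniteProtocol G s r A)
    (p : Sym2 V → ℝ) : reliability G s r A p ≤ optimalReliability G s r p :=
  (optimalReliability_isGreatest G s r p).2 ⟨A, hA, rfl⟩

/-- A finite protocol which is optimal for one `q` with `0 < q < 3 ^ (-m)` is optimal for all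
of them. -/
theorem optimalReliability_eq_of_eq {A : Set (V × V × V)} (hA : IsFiniteProtocol G s r A) {q₀ : ℝ}
    (h₀ : 0 < q₀) (h₀' : q₀ < ((3 : ℝ) ^ G.edgeSet.ncard)⁻¹)
    (heq : optimalReliability G s r (fun _ => 1 - q₀) = reliability G s r A (fun _ => 1 - q₀))
    {q : ℝ} (hq : 0 ≤ q) (hq' : q < ((3 : ℝ) ^ G.edgeSet.ncard)⁻¹) :
    optimalReliability G s r (fun _ => 1 - q) = reliability G s r A (fun _ => 1 - q) := by
  obtain ⟨B, hB, hBq⟩ := (optimalReliability_isGreatest G s r fun _ => 1 - q).1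
  refine le_antisymm ?_ (reliability_le_optimalReliability hA _)
  rw [← hBq]
  exact reliability_le_of_le A B h₀ h₀' (heq ▸ reliability_le_optimalReliability hB _) hq hq'

/-- A maximizer at the single point `q = 3 ^ (-m) / 2` is optimal on the whole interval. -/
theorem exists_isOptimalNearOne (G : SimpleGraph V) (s r : V) : ∃ A, IsOptimalNearOne G s r A := by
  have hδ : (0 : ℝ) < ((3 : ℝ) ^ G.edgeSet.ncard)⁻¹ := by positivity
  obtain ⟨A, hA, hAq⟩ := (optimalReliability_isGreatest G s r
    fun _ => 1 - ((3 : ℝ) ^ G.edgeSet.ncard)⁻¹ / 2).1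
  refine ⟨A, hA, _, hδ, fun p hp => ?_⟩
  have := optimalReliability_eq_of_eq hA (half_pos hδ) (half_lt_self hδ) hAq.symm
    (q := 1 - p) (by linarith [hp.2]) (by linarith [hp.1])
  rwa [sub_sub_cancel] at this

theorem IsOptimalNearOne.optimalReliability_eq {A : Set (V × V × V)}
    (hA : IsOptimalNearOne G s r A) {q : ℝ} (hq : 0 ≤ q)
    (hq' : q < ((3 : ℝ) ^ G.edgeSet.ncard)⁻¹) :
    optimalReliability G s r (fun _ => 1 - q) = reliability G s r A (fun _ => 1 - q) := by
  obtain ⟨hfin, ε, hε, hopt⟩ := hA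
  have hδ : (0 : ℝ) < ((3 : ℝ) ^ G.edgeSet.ncard)⁻¹ := by positivity
  have h0 := lt_min hε hδ
  have h1 := half_lt_self h0
  refine optimalReliability_eq_of_eq hfin (half_pos h0) (h1.trans_le (min_le_right _ _))
    (hopt _ ⟨?_, ?_⟩) hq hq'
  · have := h1.trans_le (min_le_left _ _)
    linarith
  · linarith [half_pos h0]

end Reliability

theorem mainTheorem5 {V : Type*} [Fintype V] (G : SimpleGraph V) (s r : V) (hsr : s ≠ r) :
    (∃ A₁ : Set (V × V × V), IsOptimalNearOne G s r A₁) ∧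
    ∃ C : ℝ, ∀ A₁ : Set (V × V × V), IsOptimalNearOne G s r A₁ →
      ∀ q : ℝ, 0 ≤ q → q < ((3 : ℝ) ^ G.edgeSet.ncard)⁻¹ →
        optimalReliability G s r (fun _ => 1 - q) = reliability G s r A₁ (fun _ => 1 - q) ∧
        |reliability G s r A₁ (fun _ => 1 - q) -
            (1 - (numMinEdgeCuts G s r : ℝ) * q ^ edgeConnectivity G s r)|
          ≤ C * q ^ (edgeConnectivity G s r + 1) := by
  -- The constant adds the error terms of the lower and the upper bound.
  refine ⟨exists_isOptimalNearOne G s r,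
    2 ^ G.edgeSet.ncard + numMinEdgeCuts G s r * G.edgeSet.ncard, fun A₁ hA₁ q hq hq' => ?_⟩
  have heq := hA₁.optimalReliability_eq hq hq'
  refine ⟨heq, ?_⟩
  have hq1 : q ≤ 1 := hq'.le.trans (inv_le_one_of_one_le₀ (one_le_pow₀ (by norm_num)))
  obtain ⟨B, hB, hdel⟩ := exists_finite_protocol_delivers G hsr
  have h1 := reliability_le_of_minEdgeCuts (G := G) (s := s) (r := r) A₁ hq hq1
  have h2 := le_reliability_of_delivers hdel hq hq1
  have h3 := reliability_le_optimalReliability hB fun _ => 1 - q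
  rw [heq] at h3
  have h4 : (0 : ℝ) ≤ 2 ^ G.edgeSet.ncard * q ^ (edgeConnectivity G s r + 1) := by positivity
  have h5 : (0 : ℝ) ≤ numMinEdgeCuts G s r * G.edgeSet.ncard *
    q ^ (edgeConnectivity G s r + 1) := by positivity
  rw [abs_le]
  constructor <;> linarith
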